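/- Let $\mathbb H_1=\mathbb R^3$ be the Heisenberg group with law $(a,b,c)(a',b',c')=(a+a',b+b',c+c'+ab')$, let $\Gamma=\mathbb Z^3\subset\mathbb H_1$, and let $M=\Gamma\backslash\mathbb H_1$ carry the measure induced by $da\,db\,dc$ (total mass $1$). Let $A_M,B_M$ be the vector fields on $M$ induced by the left-invariant fields $A=\partial_a$, $B=\partial_b+a\,\partial_c$, let $\mathcal L_M=-(A_M^2+B_M^2)$ be the canonical sub-Laplacian, understood as the self-adjoint operator on $L^2(M)$ obtained as the closure from $C^\infty(M)$, and for $\mu\ge 0$ let $\Pi_\mu$ be the spectral projector of $\sqrt{\mathcal L_M}$ at $\mu$, that is, the orthogonal projection of $L^2(M)$ onto $\ker(\mathcal L_M-\mu^2)$. There is a constant $C>0$ such that, for every $\mu>0$ in the spectrum of $\sqrt{\mathcal L_M}$, $$\|\Pi_\mu\|_{\mathscr L(L^2(M),L^4(M))}=\|\Pi_\mu\|_{\mathscr L(L^{4/3}(M),L^2(M))}<\infty ,$$ and, if moreover $\mu$ is not one of the frequencies $2\pi|\omega|$, $\omega\in\mathbb Z^2$, of the flat torus $\mathbb T^2=\mathbb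 R^2/\mathbb Z^2$, $$\|\Pi_\mu\|_{\mathscr L(L^2(M),L^4(M))}\ \ge\ C\,\mu^{1/2}.$$ Consequently the exponent $1/2$ in the bound $\|\Pi_\mu\|_{\mathscr L(L^2(M),L^4(M))}\le C_\epsilon\,\mu^{1/2+\epsilon}$ is optimal: for no real $\alpha<1/2$ is there a constant $C'$ such that $\|\Pi_\mu\|_{\mathscr L(L^2(M),L^4(M))}\le C'\mu^{\alpha}$ for all $\mu>0$ in the spectrum of $\sqrt{\mathcal L_M}$. -/

import Mathlib

open MeasureTheory Set
open scoped ENNReal ContDiff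

noncomputable section

namespace HeisNil

/-! ### The Heisenberg group, its integer lattice and the nilmanifold -/

/-- The three-dimensional Heisenberg group, i.e. the upper triangular unipotent real matrices
with entries `a` (position 12), `b` (position 23) and `c` (position 13). -/
@[ext] structure Heis where
  a : ℝ
  b : ℝ
  c : ℝ

namespace Heis

instance : Mul Heis := ⟨fun x y => ⟨x.a + y.a, x.b + y.b, x.c + y.c + x.a * y.b⟩⟩
instance : One Heis := ⟨⟨0, 0, 0⟩⟩
instance : Inv Heis := ⟨fun x => ⟨-x.a, -x.b, -x.c + x.a * x.b⟩⟩

@[simp] theorem mul_a (x y : Heis) : (x * y).a = x.a + y.a := rfl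
@[simp] theorem mul_b (x y : Heis) : (x * y).b = x.b + y.b := rfl
@[simp] theorem mul_c (x y : Heis) : (x * y).c = x.c + y.c + x.a * y.b := rfl
@[simp] theorem one_a : (1 : Heis).a = 0 := rfl
@[simp] theorem one_b : (1 : Heis).b = 0 := rfl
@[simp] theorem one_c : (1 : Heis).c = 0 := rfl
@[simp] theorem inv_a (x : Heis) : (x⁻¹).a = -x.a := rfl
@[simp] theorem inv_b (x : Heis) : (x⁻¹).b = -x.b := rfl
@[simp] theorem inv_c (x : Heis) : (x⁻¹).c = -x.c + x.a * x.b := rfl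

instance : Group Heis where
  mul_assoc x y z := by ext <;> simp <;> ring
  one_mul x := by ext <;> simp
  mul_one x := by ext <;> simp
  inv_mul_cancel x := by ext <;> simp

/-- The global chart `ℝ³ → Heis`. -/
def ofCoord (p : ℝ × ℝ × ℝ) : Heis := ⟨p.1, p.2.1, p.2.2⟩

/-- The inverse chart `Heis → ℝ³`. -/
def toCoord (x : Heis) : ℝ × ℝ × ℝ := (x.a, x.b, x.c)

/-- The Borel structure of the Heisenberg group, transported from `ℝ³`. -/
instance : MeasurableSpace Heis := MeasurableSpace.comap toCoord inferInstance

theorem measurable_ofCoord : Measurable ofCoord := by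
  rintro _ ⟨t, ht, rfl⟩
  exact ht

end Heis

/-- The discrete subgroup of the elements with integer coordinates. -/
def lattice : Subgroup Heis where
  carrier := {x | ∃ k l m : ℤ, x = ⟨k, l, m⟩}
  mul_mem' := by
    rintro _ _ ⟨k, l, m, rfl⟩ ⟨k', l', m', rfl⟩
    exact ⟨k + k', l + l', m + m' + k * l', by ext <;> simp⟩
  one_mem' := ⟨0, 0, 0, by ext <;> simp⟩
  inv_mem' := by
    rintro _ ⟨k, l, m, rfl⟩
    exact ⟨-k, -l, -m + k * l, by ext <;> simp⟩

/-- The Heisenberg nilmanifold `M = Γ \ ℍ₁`, whose elements are the classes `Γ x`.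
It carries the quotient σ-algebra. -/
abbrev Nil : Type := Quotient (QuotientGroup.rightRel lattice)

/-- The class `Γ x`. -/
def toNil (x : Heis) : Nil := Quotient.mk _ x

theorem toNil_mul_left {γ : Heis} (hγ : γ ∈ lattice) (x : Heis) : toNil (γ * x) = toNil x := by
  refine Quotient.sound (QuotientGroup.rightRel_apply.2 ?_)
  simpa using lattice.inv_mem hγ

/-- The right translation `Γ x ↦ Γ x g`. -/
def rmul (g : Heis) : Nil → Nil :=
  Quotient.map (fun x => x * g) (by
    intro x y h
    have h' := QuotientGroup.rightRel_apply.1 h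
    refine QuotientGroup.rightRel_apply.2 ?_
    simpa [mul_assoc] using h')

theorem rmul_toNil (g x : Heis) : rmul g (toNil x) = toNil (x * g) := rfl

/-- The projection `ℝ³ → M` in coordinates. -/
def nilCoord (p : ℝ × ℝ × ℝ) : Nil := toNil (Heis.ofCoord p)

theorem measurable_nilCoord : Measurable nilCoord :=
  measurable_quotient_mk''.comp Heis.measurable_ofCoord

/-- The fundamental domain `[0,1)³`. -/
def cube : Set (ℝ × ℝ × ℝ) := Ico 0 1 ×ˢ (Ico 0 1 ×ˢ Ico 0 1)

/-- The measure on `M` induced by the Haar measure `da db dc`: it is `da db dc` on the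
fundamental domain `[0,1)³`. -/
def nilVol : Measure Nil := (volume.restrict cube).map nilCoord

theorem volume_cube : volume cube = 1 := by
  simp [cube, Measure.volume_eq_prod, Measure.prod_prod]

instance : IsProbabilityMeasure nilVol := by
  refine ⟨?_⟩
  rw [nilVol, Measure.map_apply measurable_nilCoord MeasurableSet.univ]
  simp [volume_cube]

theorem exists_cube (x : Nil) : ∃ p ∈ cube, nilCoord p = x := by
  obtain ⟨g, rfl⟩ := Quotient.exists_rep x
  let k : ℤ := ⌊g.a⌋
  let l : ℤ := ⌊g.b⌋
  let m : ℤ := ⌊g.c - k * (g.b - l)⌋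
  have hfl : ∀ t : ℝ, t - ⌊t⌋ ∈ Ico (0 : ℝ) 1 := fun t =>
    ⟨sub_nonneg.2 (Int.floor_le t), by linarith [Int.lt_floor_add_one t]⟩
  refine ⟨(g.a - k, g.b - l, g.c - k * (g.b - l) - m), ⟨hfl _, hfl _, hfl _⟩, ?_⟩
  have hγ : (⟨k, l, m⟩ : Heis) ∈ lattice := ⟨k, l, m, rfl⟩
  have := toNil_mul_left hγ (Heis.ofCoord (g.a - k, g.b - l, g.c - k * (g.b - l) - m))
  rw [nilCoord, ← this]
  change toNil _ = toNil g
  congr 1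
  ext <;> simp [Heis.ofCoord]

/-! ### Smooth functions, the left-invariant fields and the sub-Laplacian -/

/-- The space `C^∞(M)`: the functions on `M` whose lift to `ℍ₁ ≃ ℝ³` is smooth. -/
def smoothFun : Submodule ℂ (Nil → ℂ) where
  carrier := {f | ContDiff ℝ ∞ (fun p => f (nilCoord p))}
  add_mem' := by
    intro f g (hf : ContDiff ℝ ∞ _) (hg : ContDiff ℝ ∞ _)
    exact hf.add hg
  zero_mem' := by
    change ContDiff ℝ ∞ (fun _ : ℝ × ℝ × ℝ => (0 : ℂ))
    exact contDiff_const
  smul_mem' := by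
    intro z f (hf : ContDiff ℝ ∞ _)
    exact hf.const_smul z

theorem smooth_lift {f : Nil → ℂ} (hf : f ∈ smoothFun) :
    ContDiff ℝ ∞ (fun p => f (nilCoord p)) := hf

/-- The field `A_M`, induced on `M` by `A = ∂_a`: `A_M f (ẋ) = d/dt f (ẋ exp (t A))` at `t = 0`. -/
def fieldA (f : Nil → ℂ) (x : Nil) : ℂ := deriv (fun t : ℝ => f (rmul ⟨t, 0, 0⟩ x)) 0

/-- The field `B_M`, induced on `M` by `B = ∂_b + a ∂_c`:
`B_M f (ẋ) = d/dt f (ẋ exp (t B))` at `t = 0`. -/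
def fieldB (f : Nil → ℂ) (x : Nil) : ℂ := deriv (fun t : ℝ => f (rmul ⟨0, t, 0⟩ x)) 0

theorem fieldA_nilCoord {f : Nil → ℂ} (hf : f ∈ smoothFun) (p : ℝ × ℝ × ℝ) :
    fieldA f (nilCoord p) = fderiv ℝ (fun q => f (nilCoord q)) p (1, 0, 0) := by
  have hF : DifferentiableAt ℝ (fun q => f (nilCoord q)) p :=
    ((smooth_lift hf).differentiable (by simp)).differentiableAt
  have hc : HasDerivAt (fun t : ℝ => ((p.1 + t, p.2.1, p.2.2) : ℝ × ℝ × ℝ)) (1, 0, 0) 0 :=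
    ((hasDerivAt_id (0 : ℝ)).const_add p.1).prodMk
      ((hasDerivAt_const _ _).prodMk (hasDerivAt_const _ _))
  have h0 : ((p.1 + (0 : ℝ), p.2.1, p.2.2) : ℝ × ℝ × ℝ) = p := by simp
  have := HasFDerivAt.comp_hasDerivAt (0 : ℝ) (by rw [h0]; exact hF.hasFDerivAt) hc
  rw [← this.deriv]
  unfold fieldA
  congr 1
  funext t
  simp only [Function.comp, nilCoord, rmul_toNil]
  congr 2
  ext <;> simp [Heis.ofCoord]

theorem fieldB_nilCoord {f : Nil → ℂ} (hf : f ∈ smoothFun) (p : ℝ × ℝ × ℝ) :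
    fieldB f (nilCoord p) = fderiv ℝ (fun q => f (nilCoord q)) p (0, 1, p.1) := by
  have hF : DifferentiableAt ℝ (fun q => f (nilCoord q)) p :=
    ((smooth_lift hf).differentiable (by simp)).differentiableAt
  have hc : HasDerivAt (fun t : ℝ => ((p.1, p.2.1 + t, p.2.2 + p.1 * t) : ℝ × ℝ × ℝ))
      (0, 1, p.1) 0 := by
    refine (hasDerivAt_const _ _).prodMk (HasDerivAt.prodMk ?_ ?_)
    · exact (hasDerivAt_id (0 : ℝ)).const_add p.2.1
    · simpa using ((hasDerivAt_id (0 : ℝ)).const_mul p.1).const_add p.2.2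
  have h0 : ((p.1, p.2.1 + (0 : ℝ), p.2.2 + p.1 * (0 : ℝ)) : ℝ × ℝ × ℝ) = p := by simp
  have := HasFDerivAt.comp_hasDerivAt (0 : ℝ) (by rw [h0]; exact hF.hasFDerivAt) hc
  rw [← this.deriv]
  unfold fieldB
  congr 1
  funext t
  simp only [Function.comp, nilCoord, rmul_toNil]
  congr 2
  ext <;> simp [Heis.ofCoord]

theorem fieldA_mem {f : Nil → ℂ} (hf : f ∈ smoothFun) : fieldA f ∈ smoothFun := by
  change ContDiff ℝ ∞ (fun p => fieldA f (nilCoord p))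
  simp only [fieldA_nilCoord hf]
  exact ((smooth_lift hf).fderiv_right (m := ∞) (by simp)).clm_apply contDiff_const

theorem fieldB_mem {f : Nil → ℂ} (hf : f ∈ smoothFun) : fieldB f ∈ smoothFun := by
  change ContDiff ℝ ∞ (fun p => fieldB f (nilCoord p))
  simp only [fieldB_nilCoord hf]
  exact ((smooth_lift hf).fderiv_right (m := ∞) (by simp)).clm_apply
    (contDiff_const.prodMk (contDiff_const.prodMk contDiff_fst))

theorem field_ext {u v : Nil → ℂ} (h : ∀ p, u (nilCoord p) = v (nilCoord p)) : u = v := by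
  funext x
  obtain ⟨p, -, rfl⟩ := exists_cube x
  exact h p

/-- `A_M` as a linear operator on `C^∞(M)`. -/
def opA : smoothFun →ₗ[ℂ] smoothFun where
  toFun f := ⟨fieldA f.1, fieldA_mem f.2⟩
  map_add' f g := by
    refine Subtype.ext (field_ext fun p => ?_)
    have hf := ((smooth_lift f.2).differentiable (by simp)).differentiableAt (x := p)
    have hg := ((smooth_lift g.2).differentiable (by simp)).differentiableAt (x := p)
    change fieldA (f + g : smoothFun).1 (nilCoord p)
      = fieldA f.1 (nilCoord p) + fieldA g.1 (nilCoord p)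
    rw [fieldA_nilCoord (f + g).2, fieldA_nilCoord f.2, fieldA_nilCoord g.2]
    exact congrArg (fun T => T (1, 0, 0)) (fderiv_add hf hg)
  map_smul' z f := by
    refine Subtype.ext (field_ext fun p => ?_)
    have hf := ((smooth_lift f.2).differentiable (by simp)).differentiableAt (x := p)
    change fieldA (z • f : smoothFun).1 (nilCoord p) = z • fieldA f.1 (nilCoord p)
    rw [fieldA_nilCoord (z • f).2, fieldA_nilCoord f.2]
    exact congrArg (fun T => T (1, 0, 0)) (fderiv_const_smul hf z)

/-- `B_M` as a linear operator on `C^∞(M)`. -/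
def opB : smoothFun →ₗ[ℂ] smoothFun where
  toFun f := ⟨fieldB f.1, fieldB_mem f.2⟩
  map_add' f g := by
    refine Subtype.ext (field_ext fun p => ?_)
    have hf := ((smooth_lift f.2).differentiable (by simp)).differentiableAt (x := p)
    have hg := ((smooth_lift g.2).differentiable (by simp)).differentiableAt (x := p)
    change fieldB (f + g : smoothFun).1 (nilCoord p)
      = fieldB f.1 (nilCoord p) + fieldB g.1 (nilCoord p)
    rw [fieldB_nilCoord (f + g).2, fieldB_nilCoord f.2, fieldB_nilCoord g.2]
    exact congrArg (fun T => T (0, 1, p.1)) (fderiv_add hf hg)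
  map_smul' z f := by
    refine Subtype.ext (field_ext fun p => ?_)
    have hf := ((smooth_lift f.2).differentiable (by simp)).differentiableAt (x := p)
    change fieldB (z • f : smoothFun).1 (nilCoord p) = z • fieldB f.1 (nilCoord p)
    rw [fieldB_nilCoord (z • f).2, fieldB_nilCoord f.2]
    exact congrArg (fun T => T (0, 1, p.1)) (fderiv_const_smul hf z)

/-- The canonical sub-Laplacian `- (A_M² + B_M²)` on `C^∞(M)`. -/
def subLaplacianSmooth : smoothFun →ₗ[ℂ] smoothFun := -(opA ∘ₗ opA + opB ∘ₗ opB)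

/-! ### The sub-Laplacian as a self-adjoint operator on `L²(M)` -/

/-- The Hilbert space `L²(M)`. -/
abbrev L2 : Type := Lp ℂ 2 nilVol

theorem memLp_of_smooth {f : Nil → ℂ} (hf : f ∈ smoothFun) (p : ℝ≥0∞) : MemLp f p nilVol := by
  have hc : Continuous (fun p => f (nilCoord p)) := (smooth_lift hf).continuous
  have hm : Measurable f := by
    refine measurable_from_quotient.2 ?_
    have h1 : Measurable Heis.toCoord := fun s hs => ⟨s, hs, rfl⟩
    exact hc.measurable.comp h1
  have hK : IsCompact (Icc 0 1 ×ˢ (Icc 0 1 ×ˢ Icc 0 1) : Set (ℝ × ℝ × ℝ)) :=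
    isCompact_Icc.prod (isCompact_Icc.prod isCompact_Icc)
  obtain ⟨K, hK⟩ := hK.exists_bound_of_continuousOn hc.continuousOn
  refine MemLp.of_bound hm.aestronglyMeasurable K (Filter.Eventually.of_forall fun x => ?_)
  obtain ⟨q, hq, rfl⟩ := exists_cube x
  exact hK q ⟨Ico_subset_Icc_self hq.1, Ico_subset_Icc_self hq.2.1, Ico_subset_Icc_self hq.2.2⟩

/-- The inclusion `C^∞(M) → L²(M)`. -/
def smoothToL2 : smoothFun →ₗ[ℂ] L2 where
  toFun f := (memLp_of_smooth f.2 2).toLp f.1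
  map_add' _ _ := rfl
  map_smul' _ _ := rfl

theorem smoothToL2_injective : Function.Injective smoothToL2 := by
  rw [injective_iff_map_eq_zero]
  intro f hf
  have hc : Continuous (fun p => f.1 (nilCoord p)) := (smooth_lift f.2).continuous
  have h1 : f.1 =ᵐ[nilVol] 0 := (MemLp.toLp_eq_toLp_iff (memLp_of_smooth f.2 2)
    (MemLp.zero (ε := ℂ) (p := 2) (μ := nilVol))).1 hf
  have h2 : (fun p => f.1 (nilCoord p)) =ᵐ[volume.restrict cube] fun _ => 0 :=
    ae_of_ae_map measurable_nilCoord.aemeasurable h1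
  have h3 := Measure.eqOn_of_ae_eq h2 hc.continuousOn continuousOn_const (by
    rw [cube, interior_prod_eq, interior_prod_eq, closure_prod_eq, closure_prod_eq, interior_Ico,
      closure_Ioo zero_ne_one]
    exact prod_mono Ico_subset_Icc_self (prod_mono Ico_subset_Icc_self Ico_subset_Icc_self))
  refine Subtype.ext (funext fun x => ?_)
  obtain ⟨p, hp, rfl⟩ := exists_cube x
  exact h3 hp

/-- The sub-Laplacian with domain `C^∞(M)`, as an unbounded operator on `L²(M)`. -/
def subLaplacianMin : L2 →ₗ.[ℂ] L2 where
  domain := LinearMap.range smoothToL2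
  toFun := smoothToL2 ∘ₗ subLaplacianSmooth ∘ₗ
    (LinearEquiv.ofInjective smoothToL2 smoothToL2_injective).symm.toLinearMap

/-- The self-adjoint sub-Laplacian `𝓛_M` on `L²(M)`: the operator `- (A_M² + B_M²)` is essentially
self-adjoint on `C^∞(M)`, so its self-adjoint extension is its closure. -/
def subLaplacian : L2 →ₗ.[ℂ] L2 := subLaplacianMin.closure

/-! ### Spectrum, spectral projectors and operator norms -/

section Spectral

variable {H : Type*} [NormedAddCommGroup H] [InnerProductSpace ℂ H]

/-- The resolvent set of an unbounded operator `T`: the `z` such that `T - z` has a bounded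
everywhere defined inverse. -/
def resolventSetOfPMap (T : H →ₗ.[ℂ] H) : Set ℂ :=
  {z | ∃ S : H →L[ℂ] H, (∀ v : H, ∃ u : T.domain, (u : H) = S v ∧ T u - z • (u : H) = v) ∧
    ∀ u : T.domain, S (T u - z • (u : H)) = u}

/-- The spectrum of an unbounded operator. -/
def spec (T : H →ₗ.[ℂ] H) : Set ℂ := (resolventSetOfPMap T)ᶜ

/-- The eigenspace `ker (T - z)` of an unbounded operator. -/
def eigenspace (T : H →ₗ.[ℂ] H) (z : ℂ) : Submodule ℂ H :=
  (LinearMap.ker (T.toFun - z • T.domain.subtype)).map T.domain.subtype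

/-- The spectrum of `√T` for a nonnegative self-adjoint operator `T`: by the functional calculus
it consists of the `μ ≥ 0` with `μ²` in the spectrum of `T`. -/
def sqrtSpec (T : H →ₗ.[ℂ] H) : Set ℝ := {μ | 0 ≤ μ ∧ ((μ ^ 2 : ℝ) : ℂ) ∈ spec T}

/-- The spectral projector of `√T` at `μ ≥ 0` for a nonnegative self-adjoint operator `T`: the
orthogonal projection onto `ker (√T - μ) = ker (T - μ²)`. This kernel is closed, as `T` is; the
closure is written only so that the projection is available without a proof of this fact. -/
def sqrtProj [CompleteSpace H] (T : H →ₗ.[ℂ] H) (μ : ℝ) : H →L[ℂ] H :=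
  (eigenspace T ((μ ^ 2 : ℝ) : ℂ)).topologicalClosure.starProjection

end Spectral

/-- The norm in `𝓛(L^p(M), L^q(M))`, with value `∞` if there is no bound, of an operator given on
`L²(M)`: the least `K` with `‖P f‖_q ≤ K ‖f‖_p` for all `f` in the space `L²(M) ∩ L^p(M)`, which
is dense in `L^p(M)` for finite `p`. -/
def opNorm (p q : ℝ≥0∞) (P : L2 →L[ℂ] L2) : ℝ≥0∞ :=
  sInf {K | ∀ f : L2, MemLp f p nilVol → eLpNorm (P f) q nilVol ≤ K * eLpNorm f p nilVol}

/-- The spectral projector `Π_μ` of `√𝓛_M`. -/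
def specProj (μ : ℝ) : L2 →L[ℂ] L2 := sqrtProj subLaplacian μ

/-- The spectrum of `√Δ` on the flat torus `𝕋² = ℝ²/ℤ²`, i.e. the numbers `2π|ω|` with
`ω ∈ ℤ²`. -/
def torusFreq : Set ℝ :=
  {μ | ∃ ω₁ ω₂ : ℤ, μ = 2 * Real.pi * Real.sqrt ((ω₁ : ℝ) ^ 2 + (ω₂ : ℝ) ^ 2)}

end HeisNil

end

/-! The sub-Laplacian is diagonalised by separating frequencies in the central variable `c`.
Frequency zero gives functions on the torus, with eigenvalues `(2π)²|ω|²`. At frequency `n ≥ 1`, the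
Weil–Brezin series `∑ⱼ φ(a+j+p/n) exp(2πi((nj+p)b+nc))`, with `p` modulo `n`, turns `A_M` into
`d/dx` and `B_M` into multiplication by `2πi n x`. The operator becomes the harmonic oscillator
`-d²/dx² + (2πnx)²`, with eigenvalues `2πn(2k+1)` on Hermite functions; negative frequencies follow
by complex conjugation. Symmetry, totality of these eigenfunctions (`eigFun_total`) and finiteness
of the eigenvalues below any bound (`eigVal_finite`) determine the closure: its spectrum consists of
these eigenvalues and its eigenspaces are finite-dimensional spaces of smooth functions
(`isEigenFamily`, `eigenspace_closure_eq`, `mem_of_spec`).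

Finiteness of the norm is then finite-dimensional linear algebra, and the equality of the two norms
is duality for a symmetric projection (`opNorm_lt_top`, `opNorm_dual`).

For the lower bound, let `μ` be a frequency off the torus spectrum, so `μ² = 2πN` with `N = n(2k+1)`
for some `n`, `k`. The same eigenspace then contains the ground states (`k = 0`) of central
frequency `N`: there are `N` of them, one for each `p < N`, and they are orthogonal theta functions
of squared norm `(2N)^(-1/2)`. The sum of the first `M ≈ √N/4` has squared norm `M (2N)^(-1/2)`. On
the set `0 ≤ a, b ≲ N^(-1/2)` with `c` arbitrary, these functions all have nearly the same phase, so
the sum has modulus at least `M/10` there, on a set of measure about `1/N`. Hence `(‖f‖₄/‖f‖₂)⁴ ≳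
(M⁴/N)/(M²/N) = M² ≈ N ≈ μ²` up to constants, which is the exponent `1/2` (`norm_sq_thetaSum`,
`thetaSum_lower`, `mul_eLpNorm_thetaSum_le`). Optimality follows because every `√(2πn)` with `n ≥ 1`
lies in the spectrum and carries this bound. -/

noncomputable section
namespace HeisNil

/-! ### Symmetric operators with a complete family of eigenvectors -/

section EigenFamily

variable {H : Type*} [NormedAddCommGroup H] [InnerProductSpace ℂ H] {ι : Type*}

/-- A total family of eigenvectors of a symmetric operator, with real eigenvalues of which only
finitely many (with multiplicity) lie below any bound. -/
structure IsEigenFamily (T : H →ₗ.[ℂ] H) (e : ι → H) (eig : ι → ℝ) : Prop where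
  symm : T.IsFormalAdjoint T
  mem : ∀ i, ∃ u : T.domain, (u : H) = e i ∧ T u = (eig i : ℂ) • e i
  total : ∀ v : H, (∀ i, inner ℂ (e i) v = 0) → v = 0
  fin : ∀ R : ℝ, {i | eig i ≤ R}.Finite

theorem mem_eigenspace {T : H →ₗ.[ℂ] H} {z : ℂ} {x : H} :
    x ∈ eigenspace T z ↔ ∃ u : T.domain, (u : H) = x ∧ T u = z • x := by
  constructor
  · rintro ⟨u, hu, rfl⟩
    refine ⟨u, rfl, ?_⟩
    have : T.toFun u - z • (u : H) = 0 := hu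
    exact sub_eq_zero.1 this
  · rintro ⟨u, rfl, h⟩
    refine ⟨u, ?_, rfl⟩
    change T.toFun u - z • (u : H) = 0
    exact sub_eq_zero.2 h

/-- The span of the members of a family of eigenvectors with a given eigenvalue. -/
def eigSpan (e : ι → H) (eig : ι → ℝ) (r : ℝ) : Submodule ℂ H :=
  Submodule.span ℂ (e '' {i | eig i = r})

variable {T : H →ₗ.[ℂ] H} {e : ι → H} {eig : ι → ℝ}

namespace IsEigenFamily

theorem finiteDimensional (h : IsEigenFamily T e eig) (r : ℝ) :
    FiniteDimensional ℂ (eigSpan e eig r) :=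
  FiniteDimensional.span_of_finite ℂ (((h.fin r).subset fun _ hi => le_of_eq hi).image e)

theorem eigSpan_le (h : IsEigenFamily T e eig) (r : ℝ) :
    eigSpan e eig r ≤ eigenspace T (r : ℂ) := by
  refine Submodule.span_le.2 ?_
  rintro _ ⟨i, rfl, rfl⟩
  exact mem_eigenspace.2 (h.mem i)

theorem dense_domain [CompleteSpace H] (h : IsEigenFamily T e eig) : Dense (T.domain : Set H) := by
  rw [Submodule.dense_iff_topologicalClosure_eq_top, Submodule.topologicalClosure_eq_top_iff,
    Submodule.eq_bot_iff]
  intro v hv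
  refine h.total v fun i => ?_
  obtain ⟨u, hu, -⟩ := h.mem i
  rw [← hu]
  exact (Submodule.mem_orthogonal _ _).1 hv _ u.2

theorem isClosable [CompleteSpace H] (h : IsEigenFamily T e eig) : T.IsClosable :=
  ((LinearPMap.adjoint_isClosed h.dense_domain).isClosable).leIsClosable
    (h.symm.le_adjoint h.dense_domain)

/-- The adjoint is closed and extends the symmetric operator, so it also extends the closure. -/
theorem closure_formal [CompleteSpace H] (h : IsEigenFamily T e eig) :
    T.closure.IsFormalAdjoint T := by
  have hle : T.closure ≤ T.adjoint := by
    refine LinearPMap.le_of_le_graph ?_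
    rw [← h.isClosable.graph_closure_eq_closure_graph]
    exact Submodule.topologicalClosure_minimal _
      (LinearPMap.le_graph_of_le (h.symm.le_adjoint h.dense_domain))
      (LinearPMap.adjoint_isClosed h.dense_domain)
  intro x y
  have := LinearPMap.adjoint_isFormalAdjoint h.dense_domain ⟨x, hle.1 x.2⟩ y
  rw [← this]
  congr 1
  exact hle.2 rfl

theorem inner_closure [CompleteSpace H] (h : IsEigenFamily T e eig) {r : ℝ} {x : H}
    (hx : x ∈ eigenspace T (r : ℂ)) (u : T.closure.domain) :
    inner ℂ x (T.closure u) = (r : ℂ) * inner ℂ x (u : H) := by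
  obtain ⟨w, rfl, hw⟩ := mem_eigenspace.1 hx
  have := h.closure_formal.symm w u
  rw [← this, hw, inner_smul_left]
  simp

/-- Passing to the closure creates no new eigenvectors. Subtracting from an eigenvector its
projection onto the span leaves an eigenvector orthogonal to the members with eigenvalue `r` by
projection, and to all others because eigenvectors for distinct eigenvalues are orthogonal; totality
makes it zero. -/
theorem eigenspace_closure_eq [CompleteSpace H] (h : IsEigenFamily T e eig) (r : ℝ) :
    eigenspace T.closure (r : ℂ) = eigSpan e eig r := by
  have hle := LinearPMap.le_closure T
  apply le_antisymm
  · intro x hx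
    obtain ⟨u, rfl, hu⟩ := mem_eigenspace.1 hx
    have := h.finiteDimensional r
    set y : H := (eigSpan e eig r).starProjection (u : H) with hy
    have hyF : y ∈ eigSpan e eig r := Submodule.starProjection_apply_mem _ _
    have horth : ∀ v : H, v ∈ eigenspace T.closure (r : ℂ) → ∀ i, eig i ≠ r →
        inner ℂ (e i) v = 0 := by
      intro v hv i hi
      obtain ⟨w, rfl, hw⟩ := mem_eigenspace.1 hv
      have h1 := h.inner_closure (mem_eigenspace.2 (h.mem i)) w
      rw [hw, inner_smul_right] at h1
      have h2 : ((r : ℂ) - eig i) * inner ℂ (e i) (w : H) = 0 := by rw [sub_mul, h1, sub_self]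
      refine (mul_eq_zero.1 h2).resolve_left ?_
      rw [sub_eq_zero]
      exact_mod_cast hi.symm
    have hyE : y ∈ eigenspace T.closure (r : ℂ) := by
      obtain ⟨w, hw1, hw2⟩ := mem_eigenspace.1 (h.eigSpan_le r hyF)
      refine mem_eigenspace.2 ⟨⟨w, hle.1 w.2⟩, hw1, ?_⟩
      rw [← hw2]
      exact (hle.2 rfl).symm
    have : (u : H) - y = 0 := by
      refine h.total _ fun i => ?_
      by_cases hi : eig i = r
      · have := Submodule.starProjection_inner_eq_zero (K := eigSpan e eig r) (u : H) (e i)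
          (Submodule.subset_span ⟨i, hi, rfl⟩)
        rw [← inner_conj_symm, this, map_zero]
      · rw [inner_sub_right, horth _ hx i hi, horth _ hyE i hi, sub_zero]
    rw [sub_eq_zero.1 this]
    exact hyF
  · intro x hx
    obtain ⟨w, hw1, hw2⟩ := mem_eigenspace.1 (h.eigSpan_le r hx)
    refine mem_eigenspace.2 ⟨⟨w, hle.1 w.2⟩, hw1, ?_⟩
    rw [← hw2]
    exact (hle.2 rfl).symm

theorem orthogonalFamily (h : IsEigenFamily T e eig) :
    OrthogonalFamily ℂ (fun r => eigSpan e eig r) fun r => (eigSpan e eig r).subtypeₗᵢ := by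
  intro r s hrs v w
  obtain ⟨x, hx, hx'⟩ := mem_eigenspace.1 (h.eigSpan_le r v.2)
  obtain ⟨y, hy, hy'⟩ := mem_eigenspace.1 (h.eigSpan_le s w.2)
  have h1 := h.symm x y
  rw [hx', hy', hx, hy, inner_smul_left, inner_smul_right, Complex.conj_ofReal] at h1
  have h2 : ((r : ℂ) - s) * inner ℂ (v : H) (w : H) = 0 := by rw [sub_mul, h1, sub_self]
  refine (mul_eq_zero.1 h2).resolve_left ?_
  rw [sub_eq_zero]
  exact_mod_cast hrs

/-- The members of the family need be neither orthogonal nor nonzero. Orthonormal bases are chosen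
inside each finite-dimensional span and glued, distinct eigenvalues being orthogonal by symmetry. -/
theorem exists_hilbertBasis [CompleteSpace H] (h : IsEigenFamily T e eig) :
    ∃ (κ : Type) (b : HilbertBasis κ ℂ H) (ρ : κ → ℝ), (∀ k, b k ∈ eigenspace T (ρ k : ℂ)) ∧
      ∀ k, ∃ i, eig i = ρ k := by
  have := h.finiteDimensional
  let w : (a : Σ r : ℝ, Fin (Module.finrank ℂ (eigSpan e eig r))) → H :=
    fun a => (eigSpan e eig a.1).subtypeₗᵢ (stdOrthonormalBasis ℂ (eigSpan e eig a.1) a.2)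
  have hw : Orthonormal ℂ w := h.orthogonalFamily.orthonormal_sigma_orthonormal
    fun r => (stdOrthonormalBasis ℂ (eigSpan e eig r)).orthonormal
  have hspan : (Submodule.span ℂ (range w))ᗮ = ⊥ := by
    rw [Submodule.eq_bot_iff]
    intro v hv
    refine h.total v fun i => ?_
    have hle : eigSpan e eig (eig i) ≤ Submodule.span ℂ (range w) := by
      intro x hx
      have h1 := (stdOrthonormalBasis ℂ (eigSpan e eig (eig i))).sum_repr ⟨x, hx⟩
      have h2 := congrArg (fun y : eigSpan e eig (eig i) => (y : H)) h1
      simp only [Submodule.coe_sum, Submodule.coe_smul] at h2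
      rw [← h2]
      exact Submodule.sum_mem _ fun j _ => Submodule.smul_mem _ _
        (Submodule.subset_span ⟨⟨eig i, j⟩, rfl⟩)
    exact (Submodule.mem_orthogonal _ _).1 hv _ (hle (Submodule.subset_span ⟨i, rfl, rfl⟩))
  refine ⟨_, HilbertBasis.mkOfOrthogonalEqBot hw hspan, fun a => a.1, fun a => ?_, fun a => ?_⟩
  · rw [HilbertBasis.coe_mkOfOrthogonalEqBot]
    exact h.eigSpan_le _ (stdOrthonormalBasis ℂ (eigSpan e eig a.1) a.2).2
  -- A value that is no eigenvalue has zero span, which holds no unit vector.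
  · by_contra! hne
    have hbot : eigSpan e eig a.1 = ⊥ := by
      rw [eigSpan]
      have : {i | eig i = a.1} = ∅ := by
        ext i; simpa using hne i
      simp [this]
    have h0 : stdOrthonormalBasis ℂ (eigSpan e eig a.1) a.2 = 0 := by
      refine Subtype.ext ?_
      exact (Submodule.eq_bot_iff _).1 hbot _ (stdOrthonormalBasis ℂ (eigSpan e eig a.1) a.2).2
    have h1 := (stdOrthonormalBasis ℂ (eigSpan e eig a.1)).orthonormal.1 a.2
    rw [h0] at h1
    simp at h1

/-- The bounded operator which is diagonal in a Hilbert basis, with bounded entries. -/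
theorem _root_.HilbertBasis.exists_diagonal {κ : Type*} (b : HilbertBasis κ ℂ H)
    (c : κ → ℂ) {M : ℝ} (hM : 0 ≤ M) (hc : ∀ k, ‖c k‖ ≤ M) :
    ∃ S : H →L[ℂ] H, ∀ v k, b.repr (S v) k = c k * b.repr v k := by
  have hmem : ∀ x : lp (fun _ : κ => ℂ) 2, Memℓp (fun k => c k * x k) 2 := by
    intro x
    have hx : Summable fun k => ‖x k‖ ^ (2 : ℝ≥0∞).toReal := (lp.memℓp x).summable (by norm_num)
    refine memℓp_gen ?_
    refine Summable.of_nonneg_of_le (fun k => by positivity) (fun k => ?_)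
      (hx.mul_left (M ^ (2 : ℝ≥0∞).toReal))
    rw [norm_mul, Real.mul_rpow (norm_nonneg _) (norm_nonneg _)]
    gcongr
    exact hc k
  let D : lp (fun _ : κ => ℂ) 2 →ₗ[ℂ] lp (fun _ : κ => ℂ) 2 :=
    { toFun := fun x => ⟨fun k => c k * x k, hmem x⟩
      map_add' := fun x y => by ext k; exact mul_add _ _ _
      map_smul' := fun z x => by ext k; exact mul_left_comm _ _ _ }
  have hD : ∀ x, ‖D x‖ ≤ M * ‖x‖ := by
    intro x
    refine lp.norm_le_of_forall_sum_le (p := 2) (by norm_num) (by positivity) fun s => ?_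
    have h1 := lp.sum_rpow_le_norm_rpow (p := 2) (by norm_num) x s
    rw [Real.mul_rpow hM (norm_nonneg _)]
    refine le_trans ?_ (mul_le_mul_of_nonneg_left h1 (by positivity))
    rw [Finset.mul_sum]
    refine Finset.sum_le_sum fun k _ => ?_
    change ‖c k * x k‖ ^ _ ≤ _
    rw [norm_mul, Real.mul_rpow (norm_nonneg _) (norm_nonneg _)]
    gcongr
    exact hc k
  refine ⟨(b.repr.symm.toContinuousLinearEquiv : _ →L[ℂ] H) ∘L
    (D.mkContinuous M hD) ∘L (b.repr.toContinuousLinearEquiv : H →L[ℂ] _), fun v k => ?_⟩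
  simp [D]

/-- Only finitely many indices have eigenvalue at most `r + 1`; all the others are at distance more
than `1`. -/
theorem exists_gap (h : IsEigenFamily T e eig) {r : ℝ} (hr : ∀ i, eig i ≠ r) :
    ∃ δ : ℝ, 0 < δ ∧ ∀ i, δ ≤ |eig i - r| := by
  obtain ⟨m, hm⟩ : ∃ m : ℝ, 0 < m ∧ ∀ i ∈ {i | eig i ≤ r + 1}, m ≤ |eig i - r| := by
    have hfin := h.fin (r + 1)
    rcases hfin.toFinset.eq_empty_or_nonempty with he | hne
    · refine ⟨1, one_pos, fun i hi => ?_⟩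
      have : i ∈ hfin.toFinset := hfin.mem_toFinset.2 hi
      simp [he] at this
    · obtain ⟨j, hj, hmin⟩ := hfin.toFinset.exists_min_image (fun i => |eig i - r|) hne
      exact ⟨|eig j - r|, abs_pos.2 (sub_ne_zero.2 (hr j)),
        fun i hi => hmin i (hfin.mem_toFinset.2 hi)⟩
  refine ⟨min m 1, lt_min hm.1 one_pos, fun i => ?_⟩
  by_cases hi : eig i ≤ r + 1
  · exact (min_le_left _ _).trans (hm.2 i hi)
  · refine (min_le_right _ _).trans (le_trans ?_ (le_abs_self _))
    linarith [not_le.1 hi]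

/-- Away from the eigenvalues the resolvent is the diagonal operator with entries `(ρ k - r)⁻¹`,
bounded thanks to the gap. -/
theorem mem_of_spec [CompleteSpace H] (h : IsEigenFamily T e eig) {r : ℝ}
    (hr : (r : ℂ) ∈ spec T.closure) : ∃ i, eig i = r := by
  by_contra! hne
  obtain ⟨δ, hδ, hgap⟩ := h.exists_gap hne
  obtain ⟨κ, b, ρ, hb, hρ⟩ := h.exists_hilbertBasis
  have hgap' : ∀ k, δ ≤ |ρ k - r| := fun k => by
    obtain ⟨i, hi⟩ := hρ k
    rw [← hi]
    exact hgap i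
  have hne' : ∀ k, (ρ k : ℂ) - r ≠ 0 := fun k => by
    have : ρ k - r ≠ 0 := abs_pos.1 (hδ.trans_le (hgap' k))
    exact_mod_cast this
  obtain ⟨S, hS⟩ := b.exists_diagonal (fun k => ((ρ k : ℂ) - r)⁻¹) (M := δ⁻¹) (by positivity)
    (fun k => by
      rw [norm_inv, ← Complex.ofReal_sub, Complex.norm_real, Real.norm_eq_abs]
      exact inv_anti₀ hδ (hgap' k))
  refine hr ⟨S, fun v => ?_, fun u => ?_⟩
  -- Partial sums of the basis expansion lie in the graph of `T`, so their limit lies in the graph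
  -- of the closure.
  · have hgr : (S v, v + (r : ℂ) • S v) ∈ T.closure.graph := by
      rw [← h.isClosable.graph_closure_eq_closure_graph]
      have h1 : HasSum (fun k => (b.repr (S v) k • b k,
          b.repr v k • b k + (r : ℂ) • b.repr (S v) k • b k)) (S v, v + (r : ℂ) • S v) :=
        (b.hasSum_repr (S v)).prodMk ((b.hasSum_repr v).add ((b.hasSum_repr (S v)).const_smul _))
      refine T.graph.isClosed_topologicalClosure.mem_of_tendsto h1
        (Filter.Eventually.of_forall fun s => T.graph.le_topologicalClosure ?_)
      refine Submodule.sum_mem _ fun k _ => ?_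
      obtain ⟨w, hw1, hw2⟩ := mem_eigenspace.1 (hb k)
      rw [LinearPMap.mem_graph_iff]
      refine ⟨b.repr (S v) k • w, by simp [hw1], ?_⟩
      rw [LinearPMap.map_smul, hw2, hS, ← smul_assoc, ← smul_assoc, ← add_smul]
      congr 1
      simp only [smul_eq_mul]
      field_simp [hne' k]
      ring
    obtain ⟨u, hu1, hu2⟩ := (LinearPMap.mem_graph_iff _).1 hgr
    simp only at hu1 hu2
    refine ⟨u, hu1, ?_⟩
    rw [hu2, hu1]
    abel
  · apply b.repr.injective
    ext k
    rw [hS, b.repr_apply_apply, b.repr_apply_apply, inner_sub_right, inner_smul_right,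
      h.inner_closure (hb k), ← sub_mul, inv_mul_cancel_left₀ (hne' k)]

/-- A resolvent would send `0 = (T - r) e i` to `e i`. Non-vanishing must be supplied, as the family
does not include it. -/
theorem eig_mem_spec [CompleteSpace H] (h : IsEigenFamily T e eig) {i : ι} (hi : e i ≠ 0) :
    (eig i : ℂ) ∈ spec T.closure := by
  rintro ⟨S, -, hS⟩
  have : e i ∈ eigenspace T.closure (eig i : ℂ) := by
    rw [h.eigenspace_closure_eq]
    exact Submodule.subset_span ⟨i, rfl, rfl⟩
  obtain ⟨u, hu1, hu2⟩ := mem_eigenspace.1 this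
  have h1 := hS u
  rw [hu2, hu1, sub_self, map_zero] at h1
  exact hi h1.symm

end IsEigenFamily

end EigenFamily

end HeisNil
end

noncomputable section
namespace HeisNil

/-! ### Projections onto finite-dimensional spaces of bounded functions -/

theorem eLpNorm_inner_le (f g : L2) :
    ‖inner ℂ f g‖ₑ ≤ eLpNorm f 4 nilVol * eLpNorm g (4 / 3) nilVol := by
  have h1 : ‖inner ℂ f g‖ₑ ≤ ∫⁻ x, ‖f x‖ₑ * ‖g x‖ₑ ∂nilVol := by
    rw [L2.inner_def]
    refine (enorm_integral_le_lintegral_enorm _).trans (lintegral_mono fun x => ?_)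
    rw [RCLike.inner_apply, enorm_mul, RCLike.enorm_conj, mul_comm]
  have h3 := ENNReal.lintegral_mul_le_Lp_mul_Lq nilVol (p := 4) (q := 4 / 3)
    (by rw [Real.holderConjugate_iff]; norm_num)
    (Lp.aestronglyMeasurable f).enorm (Lp.aestronglyMeasurable g).enorm
  refine h1.trans (h3.trans (le_of_eq ?_))
  rw [eLpNorm_eq_lintegral_rpow_enorm_toReal (by norm_num) (by norm_num),
    eLpNorm_eq_lintegral_rpow_enorm_toReal (by norm_num) (ENNReal.div_ne_top (by norm_num) (by norm_num))]
  norm_num [ENNReal.toReal_div]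

theorem eLpNorm_two_sq (f : L2) : eLpNorm f 2 nilVol ^ 2 = ‖inner ℂ f f‖ₑ := by
  have h1 : ‖f‖ₑ = eLpNorm f 2 nilVol := Lp.enorm_def f
  rw [← h1, inner_self_eq_norm_sq_to_K, enorm_pow]
  congr 1
  rw [← ofReal_norm, ← ofReal_norm, RCLike.norm_ofReal, abs_norm]

theorem le_opNorm {p q : ℝ≥0∞} {P : L2 →L[ℂ] L2} {f : L2} (hf : MemLp f p nilVol) :
    eLpNorm (P f) q nilVol / eLpNorm f p nilVol ≤ opNorm p q P := by
  refine le_sInf fun K hK => ?_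
  exact ENNReal.div_le_of_le_mul (hK f hf)

theorem opNorm_le {p q : ℝ≥0∞} {P : L2 →L[ℂ] L2} {K : ℝ≥0∞}
    (h : ∀ f : L2, MemLp f p nilVol → eLpNorm (P f) q nilVol ≤ K * eLpNorm f p nilVol) :
    opNorm p q P ≤ K := sInf_le h

theorem memLp_four_thirds (f : L2) : MemLp f (4 / 3) nilVol :=
  (Lp.memLp f).mono_exponent (by
    rw [ENNReal.div_le_iff (by norm_num) (by norm_num)]; norm_num)

/-- The projection is symmetric and idempotent, and `L⁴` is dual to `L^(4/3)`. Boundedness of the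
range keeps every test function in `L²`. -/
theorem opNorm_dual (E : Submodule ℂ L2) [FiniteDimensional ℂ E]
    (hE : ∀ g ∈ E, MemLp g ⊤ nilVol) :
    opNorm 2 4 E.starProjection = opNorm (4 / 3) 2 E.starProjection := by
  have hmem : ∀ f : L2, E.starProjection f ∈ E := fun f => Submodule.starProjection_apply_mem _ _
  have hmem4 : ∀ f : L2, MemLp (E.starProjection f) 4 nilVol := fun f =>
    (hE _ (hmem f)).mono_exponent le_top
  have hidem : ∀ f : L2, E.starProjection (E.starProjection f) = E.starProjection f := fun f =>
    Submodule.starProjection_eq_self_iff.2 (hmem f)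
  have hsymm : ∀ f g : L2, inner ℂ (E.starProjection f) g = inner ℂ f (E.starProjection g) :=
    fun f g => Submodule.inner_starProjection_left_eq_right E f g
  apply le_antisymm
  · refine le_sInf fun K hK => opNorm_le fun f hf => ?_
    set g := E.starProjection f with hg
    have hgb : MemLp g ⊤ nilVol := hE _ (hmem f)
    -- The extremiser in Hölder's inequality: `h = |g|² g` satisfies `⟨h, g⟩ = ‖g‖₄⁴` and `‖h‖_{4/3}
    -- = ‖g‖₄³`.
    have hh : MemLp (fun x => ((‖g x‖ ^ 2 : ℝ) : ℂ) * g x) ⊤ nilVol := by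
      have h2 : MemLp (fun x => ((‖g x‖ ^ 2 : ℝ) : ℂ)) ⊤ nilVol := by
        have h3 : MemLp (fun x => ‖g x‖ * ‖g x‖) ⊤ nilVol := hgb.norm.mul (r := ⊤) hgb.norm
        have h4 : MemLp (fun x => ‖g x‖ ^ 2) ⊤ nilVol := by simpa only [sq] using h3
        exact h4.of_le (Complex.continuous_ofReal.comp_aestronglyMeasurable h4.1)
          (Filter.Eventually.of_forall fun x => by rw [Complex.norm_real])
      exact hgb.mul (r := ⊤) h2
    have hh2 := hh.mono_exponent (p := 2) le_top
    set h : L2 := hh2.toLp _ with hhdef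
    have hcoe : h =ᵐ[nilVol] fun x => ((‖g x‖ ^ 2 : ℝ) : ℂ) * g x := hh2.coeFn_toLp
    have hn : eLpNorm h (4 / 3) nilVol = eLpNorm g 4 nilVol ^ 3 := by
      rw [eLpNorm_congr_ae hcoe,
        eLpNorm_eq_lintegral_rpow_enorm_toReal (p := 4 / 3) (by norm_num)
          (ENNReal.div_ne_top (by norm_num) (by norm_num)),
        eLpNorm_eq_lintegral_rpow_enorm_toReal (p := 4) (by norm_num) (by norm_num),
        ← ENNReal.rpow_natCast, ← ENNReal.rpow_mul]
      have : ∀ x, ‖((‖g x‖ ^ 2 : ℝ) : ℂ) * g x‖ₑ ^ ((4 / 3 : ℝ≥0∞).toReal) =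
          ‖g x‖ₑ ^ ((4 : ℝ≥0∞).toReal) := by
        intro x
        have h5 : ‖((‖g x‖ ^ 2 : ℝ) : ℂ) * g x‖ₑ = ‖g x‖ₑ ^ (3 : ℝ) := by
          rw [enorm_mul, Complex.ofReal_pow, enorm_pow]
          have : ‖((‖g x‖ : ℝ) : ℂ)‖ₑ = ‖g x‖ₑ := by
            rw [← ofReal_norm, Complex.norm_real, norm_norm, ofReal_norm]
          rw [this, ← pow_succ]
          norm_cast
        rw [h5, ← ENNReal.rpow_mul]
        norm_num [ENNReal.toReal_div]
      simp_rw [this]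
      norm_num [ENNReal.toReal_div]
    have hi : ‖inner ℂ h g‖ₑ = eLpNorm g 4 nilVol ^ 4 := by
      have h6 : inner ℂ h g = ((∫ x, ‖g x‖ ^ 4 ∂nilVol : ℝ) : ℂ) := by
        rw [L2.inner_def, ← integral_complex_ofReal]
        refine integral_congr_ae ?_
        filter_upwards [hcoe] with x hx
        rw [hx, RCLike.inner_apply, map_mul, Complex.conj_ofReal]
        have := Complex.mul_conj' (g x)
        calc g x * (((‖g x‖ ^ 2 : ℝ) : ℂ) * (starRingEnd ℂ) (g x))
            = ((‖g x‖ ^ 2 : ℝ) : ℂ) * (g x * (starRingEnd ℂ) (g x)) := by ring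
          _ = _ := by rw [this]; push_cast; ring
      have h7 : eLpNorm g 4 nilVol ^ 4 = ∫⁻ x, ‖g x‖ₑ ^ 4 ∂nilVol := by
        rw [eLpNorm_eq_lintegral_rpow_enorm_toReal (by norm_num) (by norm_num),
          ← ENNReal.rpow_natCast, ← ENNReal.rpow_mul]
        norm_num
      have hint : Integrable (fun x => ‖g x‖ ^ 4) nilVol :=
        (hmem4 f).integrable_norm_pow (p := 4) (by norm_num)
      rw [h6, ← ofReal_norm, Complex.norm_real, Real.norm_of_nonneg
        (integral_nonneg fun x => by positivity),
        ofReal_integral_eq_lintegral_ofReal hint (Filter.Eventually.of_forall fun x => by positivity),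
        h7]
      refine lintegral_congr fun x => ?_
      rw [ENNReal.ofReal_pow (norm_nonneg _), ofReal_norm]
    have hb : eLpNorm g 4 nilVol ^ 4 ≤ K * eLpNorm f 2 nilVol * eLpNorm g 4 nilVol ^ 3 := by
      rw [← hi, hg, ← hsymm]
      have h8 : ‖inner ℂ (E.starProjection h) f‖ₑ ≤ ‖E.starProjection h‖ₑ * ‖f‖ₑ := by
        rw [← ofReal_norm, ← ofReal_norm, ← ofReal_norm,
          ← ENNReal.ofReal_mul (norm_nonneg _)]
        exact ENNReal.ofReal_le_ofReal (norm_inner_le_norm _ _)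
      refine h8.trans ?_
      rw [Lp.enorm_def, Lp.enorm_def, ← hg]
      calc _ ≤ (K * eLpNorm h (4 / 3) nilVol) * eLpNorm f 2 nilVol := by
            gcongr
            exact hK h (memLp_four_thirds h)
        _ = _ := by rw [hn]; ring
    -- The factor `‖g‖₄³` may be cancelled only when it is neither zero nor infinite.
    by_cases h0 : eLpNorm g 4 nilVol = 0
    · rw [h0]; exact zero_le
    · have ht : eLpNorm g 4 nilVol ≠ ⊤ := (hmem4 f).2.ne
      have h3 : eLpNorm g 4 nilVol ^ 3 ≠ 0 := pow_ne_zero _ h0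
      have h3' : eLpNorm g 4 nilVol ^ 3 ≠ ⊤ := ENNReal.pow_ne_top ht
      rw [pow_succ', ENNReal.mul_le_mul_iff_left h3 h3'] at hb
      exact hb
  · refine le_sInf fun K hK => opNorm_le fun f hf => ?_
    set g := E.starProjection f with hg
    -- `‖Pf‖₂² = ⟨Pf, f⟩ ≤ ‖P(Pf)‖₄ ‖f‖_{4/3}`, by idempotence and Hölder.
    have h1 : eLpNorm g 2 nilVol ^ 2 ≤ K * eLpNorm f (4 / 3) nilVol * eLpNorm g 2 nilVol := by
      rw [eLpNorm_two_sq]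
      have h2 : inner ℂ g g = inner ℂ g f := by
        conv_lhs => rw [hg, ← hsymm, hidem]
      rw [h2]
      refine (eLpNorm_inner_le g f).trans ?_
      have := hK g (Lp.memLp g)
      rw [hg, hidem] at this
      calc _ ≤ (K * eLpNorm g 2 nilVol) * eLpNorm f (4 / 3) nilVol := by gcongr
        _ = _ := by ring
    by_cases h0 : eLpNorm g 2 nilVol = 0
    · rw [h0]; exact zero_le
    · rw [pow_two, ENNReal.mul_le_mul_iff_left h0 (Lp.memLp g).2.ne] at h1
      exact h1

/-- The inclusion of `E` into `L⁴` is linear on a finite-dimensional space, hence bounded. -/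
theorem opNorm_lt_top (E : Submodule ℂ L2) [FiniteDimensional ℂ E]
    (hE : ∀ g ∈ E, MemLp g ⊤ nilVol) : opNorm 2 4 E.starProjection < ⊤ := by
  have : Fact ((1 : ℝ≥0∞) ≤ 4) := ⟨by norm_num⟩
  let Φ : E →ₗ[ℂ] Lp ℂ 4 nilVol :=
    { toFun := fun g => ((hE g g.2).mono_exponent (p := 4) le_top).toLp g
      map_add' := fun f g => by
        rw [← MemLp.toLp_add, MemLp.toLp_eq_toLp_iff]
        exact Lp.coeFn_add _ _
      map_smul' := fun z f => by
        simp only [RingHom.id_apply]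
        rw [← MemLp.toLp_const_smul, MemLp.toLp_eq_toLp_iff]
        exact Lp.coeFn_smul _ _ }
  let Ψ : E →L[ℂ] Lp ℂ 4 nilVol := LinearMap.toContinuousLinearMap Φ
  refine lt_of_le_of_lt (opNorm_le (K := ‖Ψ‖ₑ) fun f _ => ?_) enorm_lt_top
  set g : E := ⟨E.starProjection f, Submodule.starProjection_apply_mem _ _⟩ with hg
  have h1 : eLpNorm (E.starProjection f) 4 nilVol = ‖Ψ g‖ₑ := by
    rw [Lp.enorm_def]
    exact eLpNorm_congr_ae (MemLp.coeFn_toLp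
      ((hE _ g.2).mono_exponent (p := 4) le_top)).symm
  have h2 : ‖g‖ ≤ ‖f‖ := Submodule.norm_starProjection_apply_le E f
  have h3 : eLpNorm f 2 nilVol = ‖f‖ₑ := (Lp.enorm_def f).symm
  rw [h1, h3, ← ofReal_norm, ← ofReal_norm, ← ofReal_norm,
    ← ENNReal.ofReal_mul (norm_nonneg _)]
  exact ENNReal.ofReal_le_ofReal ((Ψ.le_opNorm g).trans (by gcongr))

end HeisNil
end

noncomputable section
namespace HeisNil

/-! ### Integration over the nilmanifold and symmetry of the sub-Laplacian -/

/-- Lebesgue measure on `[0,1)`. -/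
def unitVol : Measure ℝ := volume.restrict (Ico 0 1)

instance : IsProbabilityMeasure unitVol := ⟨by simp [unitVol]⟩

theorem integral_unitVol {E : Type*} [NormedAddCommGroup E] [NormedSpace ℝ E] (f : ℝ → E) :
    ∫ x, f x ∂unitVol = ∫ x in (0 : ℝ)..1, f x := by
  rw [intervalIntegral.integral_of_le zero_le_one, unitVol, integral_Ico_eq_integral_Ioo,
    integral_Ioc_eq_integral_Ioo]

theorem volume_restrict_cube : volume.restrict cube = unitVol.prod (unitVol.prod unitVol) := by
  rw [unitVol, Measure.prod_restrict, Measure.prod_restrict]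
  rfl

theorem nilVol_eq : nilVol = (unitVol.prod (unitVol.prod unitVol)).map nilCoord := by
  rw [nilVol, volume_restrict_cube]

theorem measurePreserving_nilCoord :
    MeasurePreserving nilCoord (unitVol.prod (unitVol.prod unitVol)) nilVol :=
  ⟨measurable_nilCoord, nilVol_eq.symm⟩

theorem integral_nilVol {f : Nil → ℂ} (hf : AEStronglyMeasurable f nilVol) :
    ∫ x, f x ∂nilVol = ∫ p, f (nilCoord p) ∂(unitVol.prod (unitVol.prod unitVol)) := by
  rw [nilVol_eq] at hf ⊢
  rw [integral_map measurable_nilCoord.aemeasurable hf]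

theorem _root_.Continuous.integrable_unitVol₂ {f : ℝ × ℝ → ℂ} (hf : Continuous f) :
    Integrable f (unitVol.prod unitVol) := by
  rw [unitVol, Measure.prod_restrict]
  exact (hf.continuousOn.integrableOn_compact (isCompact_Icc.prod isCompact_Icc)).mono_set
    (prod_mono Ico_subset_Icc_self Ico_subset_Icc_self)

theorem _root_.Continuous.integrable_unitVol₃ {f : ℝ × ℝ × ℝ → ℂ} (hf : Continuous f) :
    Integrable f (unitVol.prod (unitVol.prod unitVol)) := by
  rw [← volume_restrict_cube]
  exact (hf.continuousOn.integrableOn_compact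
    (isCompact_Icc.prod (isCompact_Icc.prod isCompact_Icc))).mono_set
    (prod_mono Ico_subset_Icc_self (prod_mono Ico_subset_Icc_self Ico_subset_Icc_self))

/-! ### Lattice identifications and right translations in coordinates. -/

theorem nilCoord_lattice (k l m : ℤ) (a b c : ℝ) :
    nilCoord (a + k, b + l, c + m + k * b) = nilCoord (a, b, c) := by
  have hγ : (⟨k, l, m⟩ : Heis) ∈ lattice := ⟨k, l, m, rfl⟩
  rw [nilCoord, nilCoord, ← toNil_mul_left hγ (Heis.ofCoord (a, b, c))]
  congr 1
  ext <;> simp [Heis.ofCoord] <;> ring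

theorem nilCoord_add_b (a b c : ℝ) : nilCoord (a, b + 1, c) = nilCoord (a, b, c) := by
  simpa using nilCoord_lattice 0 1 0 a b c

theorem nilCoord_add_c (a b c : ℝ) : nilCoord (a, b, c + 1) = nilCoord (a, b, c) := by
  simpa using nilCoord_lattice 0 0 1 a b c

theorem nilCoord_one (b c : ℝ) : nilCoord (1, b, c + b) = nilCoord (0, b, c) := by
  simpa using nilCoord_lattice 1 0 0 0 b c

theorem rmul_a_nilCoord (t a b c : ℝ) :
    rmul ⟨t, 0, 0⟩ (nilCoord (a, b, c)) = nilCoord (a + t, b, c) := by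
  rw [nilCoord, rmul_toNil]
  congr 1
  ext <;> simp [Heis.ofCoord]

theorem rmul_b_nilCoord (t a b c : ℝ) :
    rmul ⟨0, t, 0⟩ (nilCoord (a, b, c)) = nilCoord (a, b + t, c + a * t) := by
  rw [nilCoord, rmul_toNil]
  congr 1
  ext <;> simp [Heis.ofCoord]

theorem continuous_lift {f : Nil → ℂ} (hf : f ∈ smoothFun) :
    Continuous fun p => f (nilCoord p) := (smooth_lift hf).continuous

theorem differentiable_lift {f : Nil → ℂ} (hf : f ∈ smoothFun) :
    Differentiable ℝ fun p => f (nilCoord p) := (smooth_lift hf).differentiable (by simp)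

theorem mul_mem_smooth {f g : Nil → ℂ} (hf : f ∈ smoothFun) (hg : g ∈ smoothFun) :
    f * g ∈ smoothFun := ContDiff.mul (smooth_lift hf) (smooth_lift hg)

theorem star_mem_smooth {f : Nil → ℂ} (hf : f ∈ smoothFun) : star f ∈ smoothFun :=
  Complex.conjCLE.contDiff.comp (smooth_lift hf)

theorem hasDerivAt_fieldA {f : Nil → ℂ} (hf : f ∈ smoothFun) (x : Nil) :
    HasDerivAt (fun t : ℝ => f (rmul ⟨t, 0, 0⟩ x)) (fieldA f x) 0 := by
  obtain ⟨⟨a, b, c⟩, -, rfl⟩ := exists_cube x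
  refine DifferentiableAt.hasDerivAt ?_
  simp_rw [rmul_a_nilCoord]
  exact ((differentiable_lift hf).comp (g := fun p => f (nilCoord p))
    (f := fun t : ℝ => (a + t, b, c)) (by fun_prop)).differentiableAt

theorem hasDerivAt_fieldB {f : Nil → ℂ} (hf : f ∈ smoothFun) (x : Nil) :
    HasDerivAt (fun t : ℝ => f (rmul ⟨0, t, 0⟩ x)) (fieldB f x) 0 := by
  obtain ⟨⟨a, b, c⟩, -, rfl⟩ := exists_cube x
  refine DifferentiableAt.hasDerivAt ?_
  simp_rw [rmul_b_nilCoord]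
  exact ((differentiable_lift hf).comp (g := fun p => f (nilCoord p))
    (f := fun t : ℝ => (a, b + t, c + a * t)) (by fun_prop)).differentiableAt

theorem rmul_one_a (x : Nil) : rmul ⟨0, 0, 0⟩ x = x := by
  obtain ⟨⟨a, b, c⟩, -, rfl⟩ := exists_cube x
  rw [rmul_a_nilCoord, add_zero]

theorem fieldA_mul {f g : Nil → ℂ} (hf : f ∈ smoothFun) (hg : g ∈ smoothFun) :
    fieldA (f * g) = fieldA f * g + f * fieldA g := by
  funext x
  have := ((hasDerivAt_fieldA hf x).mul (hasDerivAt_fieldA hg x)).deriv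
  rw [rmul_one_a] at this
  exact this

theorem fieldB_mul {f g : Nil → ℂ} (hf : f ∈ smoothFun) (hg : g ∈ smoothFun) :
    fieldB (f * g) = fieldB f * g + f * fieldB g := by
  funext x
  have := ((hasDerivAt_fieldB hf x).mul (hasDerivAt_fieldB hg x)).deriv
  rw [rmul_one_a] at this
  exact this

theorem fieldA_star {f : Nil → ℂ} (hf : f ∈ smoothFun) : fieldA (star f) = star (fieldA f) := by
  funext x
  exact (hasDerivAt_fieldA hf x).star.deriv

theorem fieldB_star {f : Nil → ℂ} (hf : f ∈ smoothFun) : fieldB (star f) = star (fieldB f) := by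
  funext x
  exact (hasDerivAt_fieldB hf x).star.deriv

theorem integral_unitVol_deriv {F F' : ℝ → ℂ} (h : ∀ x, HasDerivAt F (F' x) x)
    (hc : Continuous F') : ∫ x, F' x ∂unitVol = F 1 - F 0 := by
  rw [integral_unitVol]
  exact intervalIntegral.integral_eq_sub_of_hasDerivAt (fun x _ => h x)
    (hc.intervalIntegrable _ _)

theorem smooth_measurable {f : Nil → ℂ} (hf : f ∈ smoothFun) :
    AEStronglyMeasurable f nilVol := (memLp_of_smooth hf 2).1

/-- Integrating in `a` leaves the difference between the faces `a = 1` and `a = 0`. The lattice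
glues these by the shear `c ↦ c - b`, which does not change an integral over a period in `c`. -/
theorem integral_fieldA {f : Nil → ℂ} (hf : f ∈ smoothFun) : ∫ x, fieldA f x ∂nilVol = 0 := by
  have hcA := continuous_lift (fieldA_mem hf)
  have hc := continuous_lift hf
  rw [integral_nilVol (smooth_measurable (fieldA_mem hf)),
    integral_prod_symm _ hcA.integrable_unitVol₃]
  have h1 : ∀ y : ℝ × ℝ, ∫ a, fieldA f (nilCoord (a, y)) ∂unitVol =
      f (nilCoord (1, y)) - f (nilCoord (0, y)) := by
    intro y
    refine integral_unitVol_deriv (F := fun a => f (nilCoord (a, y))) (fun a => ?_)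
      (hcA.comp (by fun_prop))
    have h2 := hasDerivAt_fieldA hf (nilCoord (a, y))
    simp_rw [show nilCoord (a, y) = nilCoord (a, y.1, y.2) from rfl, rmul_a_nilCoord] at h2
    have h3 := HasDerivAt.comp_sub_const a a (by rw [sub_self]; exact h2)
    simpa using h3
  simp_rw [h1]
  have hi : ∀ s : ℝ, Integrable (fun y : ℝ × ℝ => f (nilCoord (s, y))) (unitVol.prod unitVol) :=
    fun s => Continuous.integrable_unitVol₂ (hc.comp (by fun_prop))
  rw [integral_sub (hi 1) (hi 0), integral_prod _ (hi 1), integral_prod _ (hi 0), sub_eq_zero]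
  refine integral_congr_ae (Filter.Eventually.of_forall fun b => ?_)
  simp only
  rw [integral_unitVol, integral_unitVol]
  have hper : Function.Periodic (fun c => f (nilCoord (0, b, c))) 1 := fun c => by
    simp only [nilCoord_add_c]
  calc ∫ c in (0 : ℝ)..1, f (nilCoord (1, b, c))
      = ∫ c in (0 : ℝ)..1, f (nilCoord (0, b, c - b)) := by
        refine intervalIntegral.integral_congr fun c _ => ?_
        simp only [← nilCoord_one, sub_add_cancel]
    _ = ∫ c in (0 - b)..(1 - b), f (nilCoord (0, b, c)) :=
        intervalIntegral.integral_comp_sub_right (fun c => f (nilCoord (0, b, c))) b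
    _ = ∫ c in (0 : ℝ)..1, f (nilCoord (0, b, c)) := by
        have := hper.intervalIntegral_add_eq (0 - b) 0
        rw [zero_add] at this
        rw [← this]
        congr 1
        ring

/-- Both `∂_b` and `a ∂_c` are derivatives in directions in which the lift is 1-periodic, and `a` is
constant along them. -/
theorem integral_fieldB {f : Nil → ℂ} (hf : f ∈ smoothFun) : ∫ x, fieldB f x ∂nilVol = 0 := by
  have hcB := continuous_lift (fieldB_mem hf)
  have hd := differentiable_lift hf
  have hcd : Continuous (fderiv ℝ fun q => f (nilCoord q)) :=
    (smooth_lift hf).continuous_fderiv (by simp)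
  have hsplit : ∀ p : ℝ × ℝ × ℝ, fieldB f (nilCoord p) =
      fderiv ℝ (fun q => f (nilCoord q)) p (0, 1, 0) +
      (p.1 : ℂ) * fderiv ℝ (fun q => f (nilCoord q)) p (0, 0, 1) := by
    intro p
    rw [fieldB_nilCoord hf]
    have : ((0, 1, p.1) : ℝ × ℝ × ℝ) = (0, 1, 0) + p.1 • (0, 0, 1) := by simp
    rw [this, map_add, map_smul, Complex.real_smul]
  rw [integral_nilVol (smooth_measurable (fieldB_mem hf))]
  simp_rw [hsplit]
  have hc1 : Continuous fun p => fderiv ℝ (fun q => f (nilCoord q)) p (0, 1, 0) :=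
    hcd.clm_apply continuous_const
  have hc2 : Continuous fun p => fderiv ℝ (fun q => f (nilCoord q)) p (0, 0, 1) :=
    hcd.clm_apply continuous_const
  have hc3 : Continuous fun p : ℝ × ℝ × ℝ =>
      (p.1 : ℂ) * fderiv ℝ (fun q => f (nilCoord q)) p (0, 0, 1) :=
    (Complex.continuous_ofReal.comp continuous_fst).mul hc2
  have hb : ∀ a c b : ℝ, HasDerivAt (fun b => f (nilCoord (a, b, c)))
      (fderiv ℝ (fun q => f (nilCoord q)) (a, b, c) (0, 1, 0)) b := fun a c b =>
    HasFDerivAt.comp_hasDerivAt (f := fun b : ℝ => (a, b, c)) b (hd (a, b, c)).hasFDerivAt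
      ((hasDerivAt_const _ _).prodMk ((hasDerivAt_id b).prodMk (hasDerivAt_const _ _)))
  have hcc : ∀ a b c : ℝ, HasDerivAt (fun c => f (nilCoord (a, b, c)))
      (fderiv ℝ (fun q => f (nilCoord q)) (a, b, c) (0, 0, 1)) c := fun a b c =>
    HasFDerivAt.comp_hasDerivAt (f := fun c : ℝ => (a, b, c)) c (hd (a, b, c)).hasFDerivAt
      ((hasDerivAt_const _ _).prodMk ((hasDerivAt_const _ _).prodMk (hasDerivAt_id c)))
  rw [integral_add hc1.integrable_unitVol₃ hc3.integrable_unitVol₃,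
    integral_prod _ hc1.integrable_unitVol₃, integral_prod _ hc3.integrable_unitVol₃]
  have e1 : ∀ a : ℝ, ∫ y : ℝ × ℝ, fderiv ℝ (fun q => f (nilCoord q)) (a, y) (0, 1, 0)
      ∂(unitVol.prod unitVol) = 0 := by
    intro a
    have hca := hc1.comp (Continuous.prodMk_right a)
    simp only [Function.comp_def] at hca
    rw [integral_prod_symm _ hca.integrable_unitVol₂]
    have : ∀ c : ℝ, ∫ b, fderiv ℝ (fun q => f (nilCoord q)) (a, b, c) (0, 1, 0) ∂unitVol = 0 := by
      intro c
      rw [integral_unitVol_deriv (hb a c) (hc1.comp (by fun_prop)), sub_eq_zero]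
      simpa using congrArg f (nilCoord_add_b a 0 c)
    simp [this]
  have e2 : ∀ a : ℝ, ∫ y : ℝ × ℝ, (a : ℂ) * fderiv ℝ (fun q => f (nilCoord q)) (a, y) (0, 0, 1)
      ∂(unitVol.prod unitVol) = 0 := by
    intro a
    have hca := hc2.comp (Continuous.prodMk_right a)
    simp only [Function.comp_def] at hca
    rw [integral_const_mul, integral_prod _ hca.integrable_unitVol₂]
    have : ∀ b : ℝ, ∫ c, fderiv ℝ (fun q => f (nilCoord q)) (a, b, c) (0, 0, 1) ∂unitVol = 0 := by
      intro b
      rw [integral_unitVol_deriv (hcc a b) (hc2.comp (by fun_prop)), sub_eq_zero]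
      simpa using congrArg f (nilCoord_add_c a b 0)
    simp [this]
  simp [e1, e2]

theorem inner_smoothToL2 (f g : smoothFun) :
    inner ℂ (smoothToL2 f) (smoothToL2 g) = ∫ x, (star f.1 * g.1) x ∂nilVol := by
  rw [L2.inner_def]
  refine integral_congr_ae ?_
  filter_upwards [(memLp_of_smooth f.2 2).coeFn_toLp, (memLp_of_smooth g.2 2).coeFn_toLp]
    with x hx hy
  change inner ℂ ((memLp_of_smooth f.2 2).toLp f.1 x) ((memLp_of_smooth g.2 2).toLp g.1 x) = _
  rw [hx, hy, RCLike.inner_apply, mul_comm]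
  rfl

theorem integrable_smooth {f : Nil → ℂ} (hf : f ∈ smoothFun) : Integrable f nilVol :=
  memLp_one_iff_integrable.1 (memLp_of_smooth hf 1)

/-- Integration by parts: the field has integral zero on the product `f̄ g`. -/
theorem inner_opA (f g : smoothFun) :
    inner ℂ (smoothToL2 (opA f)) (smoothToL2 g) = -inner ℂ (smoothToL2 f) (smoothToL2 (opA g)) := by
  rw [inner_smoothToL2, inner_smoothToL2, ← add_eq_zero_iff_eq_neg, ← integral_add
    (integrable_smooth (mul_mem_smooth (star_mem_smooth (opA f).2) g.2))
    (integrable_smooth (mul_mem_smooth (star_mem_smooth f.2) (opA g).2))]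
  have := integral_fieldA (mul_mem_smooth (star_mem_smooth f.2) g.2)
  rw [fieldA_mul (star_mem_smooth f.2) g.2, fieldA_star f.2] at this
  exact this

theorem inner_opB (f g : smoothFun) :
    inner ℂ (smoothToL2 (opB f)) (smoothToL2 g) = -inner ℂ (smoothToL2 f) (smoothToL2 (opB g)) := by
  rw [inner_smoothToL2, inner_smoothToL2, ← add_eq_zero_iff_eq_neg, ← integral_add
    (integrable_smooth (mul_mem_smooth (star_mem_smooth (opB f).2) g.2))
    (integrable_smooth (mul_mem_smooth (star_mem_smooth f.2) (opB g).2))]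
  have := integral_fieldB (mul_mem_smooth (star_mem_smooth f.2) g.2)
  rw [fieldB_mul (star_mem_smooth f.2) g.2, fieldB_star f.2] at this
  exact this

theorem inner_subLaplacianSmooth (f g : smoothFun) :
    inner ℂ (smoothToL2 (subLaplacianSmooth f)) (smoothToL2 g) =
      inner ℂ (smoothToL2 f) (smoothToL2 (subLaplacianSmooth g)) := by
  have h : ∀ f, smoothToL2 (subLaplacianSmooth f) =
      -(smoothToL2 (opA (opA f)) + smoothToL2 (opB (opB f))) := fun f => by
    simp [subLaplacianSmooth]
  rw [h, h, inner_neg_left, inner_neg_right, inner_add_left, inner_add_right, inner_opA, inner_opA,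
    inner_opB, inner_opB, neg_neg, neg_neg]

theorem subLaplacianMin_apply (f : smoothFun) :
    subLaplacianMin ⟨smoothToL2 f, ⟨f, rfl⟩⟩ = smoothToL2 (subLaplacianSmooth f) := by
  change smoothToL2 (subLaplacianSmooth
    ((LinearEquiv.ofInjective smoothToL2 smoothToL2_injective).symm ⟨smoothToL2 f, ⟨f, rfl⟩⟩)) = _
  congr 2
  rw [LinearEquiv.symm_apply_eq]
  rfl

theorem subLaplacianMin_symm : subLaplacianMin.IsFormalAdjoint subLaplacianMin := by
  rintro ⟨_, f, rfl⟩ ⟨_, g, rfl⟩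
  rw [subLaplacianMin_apply, subLaplacianMin_apply]
  exact inner_subLaplacianSmooth f g

end HeisNil
end

noncomputable section
namespace HeisNil
open Polynomial

/-! ### The Weil–Brezin transform of Hermite-type functions -/

theorem polynomial_norm_le_exp (P : ℂ[X]) :
    ∃ C : ℝ, 0 ≤ C ∧ ∀ x : ℝ, ‖P.eval (x : ℂ)‖ ≤ C * Real.exp |x| := by
  induction P using Polynomial.induction_on' with
  | add P Q hP hQ =>
    obtain ⟨C, hC, h⟩ := hP
    obtain ⟨D, hD, h'⟩ := hQ
    refine ⟨C + D, by positivity, fun x => ?_⟩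
    rw [eval_add, add_mul]
    exact (norm_add_le _ _).trans (add_le_add (h x) (h' x))
  | monomial k z =>
    refine ⟨‖z‖ * k.factorial, by positivity, fun x => ?_⟩
    rw [eval_monomial, norm_mul, norm_pow, Complex.norm_real, Real.norm_eq_abs, mul_assoc]
    gcongr
    have := Real.pow_div_factorial_le_exp |x| (abs_nonneg x) k
    rw [div_le_iff₀ (by positivity)] at this
    linarith

theorem polynomial_gauss_bound {n : ℕ} (hn : 0 < n) (P : ℂ[X]) :
    ∃ C : ℝ, 0 ≤ C ∧ ∀ x : ℝ, ‖P.eval (x : ℂ)‖ * Real.exp (-Real.pi * n * x ^ 2) ≤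
      C * Real.exp (-|x|) := by
  obtain ⟨C, hC, h⟩ := polynomial_norm_le_exp P
  refine ⟨C * Real.exp 1, by positivity, fun x => ?_⟩
  have hn' : (1 : ℝ) ≤ n := by exact_mod_cast hn
  have h1 : (1 : ℝ) ≤ Real.pi * n := by nlinarith [Real.pi_gt_three]
  -- From `πn ≥ 1` and `(|x| - 1)² ≥ 0`; one `|x|` pays for the growth of the polynomial, the other
  -- remains.
  have h2 : -Real.pi * n * x ^ 2 ≤ 1 - 2 * |x| := by
    nlinarith [sq_nonneg (|x| - 1), sq_abs x, sq_nonneg x]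
  calc _ ≤ (C * Real.exp |x|) * Real.exp (1 - 2 * |x|) :=
        mul_le_mul (h x) (Real.exp_le_exp.2 h2) (Real.exp_nonneg _) (by positivity)
    _ = _ := by
        rw [mul_assoc, mul_assoc, ← Real.exp_add, ← Real.exp_add]
        ring_nf

theorem summable_exp_neg_abs_int : Summable fun j : ℤ => Real.exp (-|(j : ℝ)|) := by
  have h : Summable fun k : ℕ => Real.exp (-(k : ℝ)) := Real.summable_exp_neg_nat
  refine Summable.of_nat_of_neg ?_ ?_ <;> simpa using h

/-- The `j`-th summand of the Weil–Brezin series of `P(x) exp (-π n x²)`. -/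
def wterm (n : ℕ) (p : ℤ) (P : ℂ[X]) (a b c : ℝ) (j : ℤ) : ℂ :=
  P.eval ((a + j + p / n : ℝ) : ℂ) * Complex.exp (-(Real.pi * n * (a + j + p / n) ^ 2) +
    2 * Real.pi * Complex.I * ((n * j + p) * b + n * c))

/-- The Weil–Brezin series of `P(x) exp (-π n x²)`. -/
def wsum (n : ℕ) (p : ℤ) (P : ℂ[X]) (a b c : ℝ) : ℂ := ∑' j : ℤ, wterm n p P a b c j

theorem norm_wterm (n : ℕ) (p : ℤ) (P : ℂ[X]) (a b c : ℝ) (j : ℤ) :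
    ‖wterm n p P a b c j‖ = ‖P.eval ((a + j + p / n : ℝ) : ℂ)‖ *
      Real.exp (-Real.pi * n * (a + j + p / n) ^ 2) := by
  rw [wterm, norm_mul, Complex.norm_exp]
  congr 2
  have : (-(Real.pi * n * (a + j + p / n) ^ 2) +
    2 * Real.pi * Complex.I * ((n * j + p) * b + n * c) : ℂ) =
    ((-Real.pi * n * (a + j + p / n) ^ 2 : ℝ) : ℂ) +
      ((2 * Real.pi * ((n * j + p) * b + n * c) : ℝ) : ℂ) * Complex.I := by
    push_cast; ring
  rw [this, Complex.add_re, Complex.ofReal_re, Complex.re_ofReal_mul, Complex.I_re]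
  ring

/-- The bound does not depend on `b` and `c`, which enter only through a phase. It licenses all the
termwise operations on the series. -/
theorem wterm_bound {n : ℕ} (hn : 0 < n) (p : ℤ) (P : ℂ[X]) :
    ∃ C : ℝ, 0 ≤ C ∧ ∀ a b c j, ‖wterm n p P a b c j‖ ≤
      C * Real.exp |a| * Real.exp (-|(j : ℝ)|) := by
  obtain ⟨C, hC, h⟩ := polynomial_gauss_bound hn P
  refine ⟨C * Real.exp |(p : ℝ) / n|, by positivity, fun a b c j => ?_⟩
  rw [norm_wterm]
  refine (h _).trans ?_
  rw [mul_assoc, mul_assoc, ← Real.exp_add, ← Real.exp_add]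
  gcongr
  have h1 : |(j : ℝ)| ≤ |a + j + p / n| + |a| + |(p : ℝ) / n| := by
    calc |(j : ℝ)| = |(a + j + p / n) - a - p / n| := by congr 1; ring
      _ ≤ |(a + j + p / n) - a| + |(p : ℝ) / n| := abs_sub _ _
      _ ≤ _ := by gcongr; exact abs_sub _ _
  linarith

theorem summable_wterm {n : ℕ} (hn : 0 < n) (p : ℤ) (P : ℂ[X]) (a b c : ℝ) :
    Summable (wterm n p P a b c) := by
  obtain ⟨C, -, h⟩ := wterm_bound hn p P
  exact Summable.of_norm_bounded (summable_exp_neg_abs_int.mul_left _) (h a b c)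

/-- The action of `A_M` on the symbol `P`. -/
def symA (n : ℕ) (P : ℂ[X]) : ℂ[X] := derivative P - C (2 * Real.pi * n : ℂ) * (X * P)

/-- The action of `B_M` on the symbol `P`. -/
def symB (n : ℕ) (P : ℂ[X]) : ℂ[X] := C (2 * Real.pi * Complex.I * n : ℂ) * (X * P)

theorem hasDerivAt_wterm_a (n : ℕ) (p : ℤ) (P : ℂ[X]) (a b c : ℝ) (j : ℤ) (t : ℝ) :
    HasDerivAt (fun t : ℝ => wterm n p P (a + t) b c j) (wterm n p (symA n P) (a + t) b c j) t := by
  have hx : HasDerivAt (fun t : ℝ => ((a + t + j + p / n : ℝ) : ℂ)) 1 t :=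
    (((((hasDerivAt_id t).const_add a).add_const (j : ℝ)).add_const ((p : ℝ) / n))).ofReal_comp
  have h1 := (P.hasDerivAt ((a + t + j + p / n : ℝ) : ℂ)).comp t hx
  have h2 := ((((hx.pow 2).const_mul (Real.pi * n : ℂ)).neg).add_const
    (2 * Real.pi * Complex.I * ((n * j + p) * b + n * c))).cexp
  have h3 := h1.mul h2
  refine (h3.congr_of_eventuallyEq (Filter.Eventually.of_forall fun t => ?_)).congr_deriv ?_
  · simp [wterm]
  · simp [wterm, symA]
    ring

/-- Along this curve the phase has derivative `2πi((nj+p) + na)`, which is `2πi n x` at `x = a + j +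
p/n`. -/
theorem hasDerivAt_wterm_b {n : ℕ} (hn : 0 < n) (p : ℤ) (P : ℂ[X]) (a b c : ℝ) (j : ℤ) (t : ℝ) :
    HasDerivAt (fun t : ℝ => wterm n p P a (b + t) (c + a * t) j)
      (wterm n p (symB n P) a (b + t) (c + a * t) j) t := by
  have hb : HasDerivAt (fun t : ℝ => ((b + t : ℝ) : ℂ)) 1 t :=
    ((hasDerivAt_id t).const_add b).ofReal_comp
  have hc : HasDerivAt (fun t : ℝ => ((c + a * t : ℝ) : ℂ)) a t := by
    simpa using (((hasDerivAt_id t).const_mul a).const_add c).ofReal_comp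
  have h1 := ((((hb.const_mul (n * j + p : ℂ)).add (hc.const_mul (n : ℂ))).const_mul
    (2 * Real.pi * Complex.I)).const_add (-(Real.pi * n * (a + j + p / n) ^ 2) : ℂ)).cexp.const_mul
    (P.eval ((a + j + p / n : ℝ) : ℂ))
  have : (n : ℂ) ≠ 0 := by exact_mod_cast hn.ne'
  refine (h1.congr_of_eventuallyEq (Filter.Eventually.of_forall fun t => ?_)).congr_deriv ?_
  · simp [wterm]
  · simp [wterm, symB]
    field_simp
    ring

theorem hasDerivAt_wsum_a {n : ℕ} (hn : 0 < n) (p : ℤ) (P : ℂ[X]) (a b c : ℝ) :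
    HasDerivAt (fun t : ℝ => wsum n p P (a + t) b c) (wsum n p (symA n P) a b c) 0 := by
  obtain ⟨C, hC, h⟩ := wterm_bound hn p (symA n P)
  -- The majorant grows with `|a + t|`, so `t` is confined to `(-1, 1)`; in the direction of `B`
  -- this is unnecessary.
  have := hasDerivAt_tsum_of_isPreconnected (t := Ioo (-1 : ℝ) 1) (y₀ := 0) (y := 0)
    (g := fun j t => wterm n p P (a + t) b c j)
    (summable_exp_neg_abs_int.mul_left (C * Real.exp (|a| + 1)))
    isOpen_Ioo isPreconnected_Ioo (fun j t _ => hasDerivAt_wterm_a n p P a b c j t)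
    (fun j t ht => (h (a + t) b c j).trans (by
      gcongr
      exact (abs_add_le _ _).trans (by gcongr; exact abs_le.2 ⟨ht.1.le, ht.2.le⟩)))
    (by simp) (by simpa using summable_wterm hn p P a b c) (by simp)
  simpa [wsum] using this

theorem hasDerivAt_wsum_b {n : ℕ} (hn : 0 < n) (p : ℤ) (P : ℂ[X]) (a b c : ℝ) :
    HasDerivAt (fun t : ℝ => wsum n p P a (b + t) (c + a * t)) (wsum n p (symB n P) a b c) 0 := by
  obtain ⟨C, hC, h⟩ := wterm_bound hn p (symB n P)
  have := hasDerivAt_tsum (y₀ := 0)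
    (g := fun j t => wterm n p P a (b + t) (c + a * t) j)
    (summable_exp_neg_abs_int.mul_left (C * Real.exp |a|))
    (fun j t => hasDerivAt_wterm_b hn p P a b c j t)
    (fun j t => h a (b + t) (c + a * t) j)
    (by simpa using summable_wterm hn p P a b c) 0
  simpa [wsum] using this

/-- The lattice shifts the summation index by `k`; what remains of the phase is an integer multiple
of `2πi`. -/
theorem wterm_lattice {n : ℕ} (p : ℤ) (P : ℂ[X]) (a b c : ℝ) (k l m j : ℤ) :
    wterm n p P (a + k) (b + l) (c + m + k * b) j = wterm n p P a b c (j + k) := by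
  have hx : a + k + j + p / n = a + ((j + k : ℤ) : ℝ) + p / n := by push_cast; ring
  rw [wterm, wterm, hx]
  congr 1
  have h1 : Complex.exp (((n * j + p) * l + n * m : ℤ) * (2 * Real.pi * Complex.I)) = 1 :=
    Complex.exp_int_mul_two_pi_mul_I _
  rw [← mul_one (Complex.exp (-(Real.pi * n * (a + ((j + k : ℤ) : ℂ) + p / n) ^ 2) + _)), ← h1,
    ← Complex.exp_add]
  congr 1
  push_cast
  ring

theorem wsum_lattice {n : ℕ} (p : ℤ) (P : ℂ[X]) (a b c : ℝ) (k l m : ℤ) :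
    wsum n p P (a + k) (b + l) (c + m + k * b) = wsum n p P a b c := by
  simp only [wsum, wterm_lattice]
  exact (Equiv.addRight k).tsum_eq (wterm n p P a b c)

/-- The function on `M` given by the Weil–Brezin series of `P(x) exp (-π n x²)`. -/
def wfun (n : ℕ) (p : ℤ) (P : ℂ[X]) : Nil → ℂ :=
  Quotient.lift (fun x : Heis => wsum n p P x.a x.b x.c) (by
    intro x y h
    obtain ⟨k, l, m, hγ⟩ := QuotientGroup.rightRel_apply.1 h
    have hy : y = ⟨k, l, m⟩ * x := by rw [← hγ]; group
    have h1 := wsum_lattice (n := n) p P x.a x.b x.c k l m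
    rw [hy, ← h1]
    simp only [Heis.mul_a, Heis.mul_b, Heis.mul_c]
    congr 1 <;> ring)

theorem wfun_nilCoord (n : ℕ) (p : ℤ) (P : ℂ[X]) (a b c : ℝ) :
    wfun n p P (nilCoord (a, b, c)) = wsum n p P a b c := rfl

theorem fieldA_wfun {n : ℕ} (hn : 0 < n) (p : ℤ) (P : ℂ[X]) :
    fieldA (wfun n p P) = wfun n p (symA n P) := by
  refine field_ext fun ⟨a, b, c⟩ => ?_
  simp only [fieldA, rmul_a_nilCoord, wfun_nilCoord]
  exact (hasDerivAt_wsum_a hn p P a b c).deriv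

theorem fieldB_wfun {n : ℕ} (hn : 0 < n) (p : ℤ) (P : ℂ[X]) :
    fieldB (wfun n p P) = wfun n p (symB n P) := by
  refine field_ext fun ⟨a, b, c⟩ => ?_
  simp only [fieldB, rmul_b_nilCoord, wfun_nilCoord]
  exact (hasDerivAt_wsum_b hn p P a b c).deriv

theorem wfun_add {n : ℕ} (hn : 0 < n) (p : ℤ) (P Q : ℂ[X]) :
    wfun n p (P + Q) = wfun n p P + wfun n p Q := by
  refine field_ext fun ⟨a, b, c⟩ => ?_
  rw [Pi.add_apply, wfun_nilCoord, wfun_nilCoord, wfun_nilCoord, wsum, wsum, wsum,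
    ← (summable_wterm hn p P a b c).tsum_add (summable_wterm hn p Q a b c)]
  refine tsum_congr fun j => ?_
  rw [wterm, eval_add, add_mul]
  rfl

theorem wfun_C_mul (n : ℕ) (p : ℤ) (z : ℂ) (P : ℂ[X]) :
    wfun n p (C z * P) = z • wfun n p P := by
  refine field_ext fun ⟨a, b, c⟩ => ?_
  rw [Pi.smul_apply, wfun_nilCoord, wfun_nilCoord, wsum, wsum, smul_eq_mul, ← tsum_mul_left]
  refine tsum_congr fun j => ?_
  rw [wterm, eval_mul, eval_C, mul_assoc]
  rfl

/-- Expanding the square in the Gaussian produces a Jacobi theta function, whose holomorphy gives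
joint smoothness in all variables. -/
theorem wsum_one {n : ℕ} (hn : 0 < n) (p : ℤ) (a b c : ℝ) :
    wsum n p 1 a b c = Complex.exp (-(Real.pi * n * a ^ 2) - Real.pi * p ^ 2 / n +
      2 * Real.pi * Complex.I * (p * (b + Complex.I * a) + n * c)) *
      jacobiTheta₂ (n * (b + Complex.I * a) + Complex.I * p) (Complex.I * n) := by
  rw [wsum, jacobiTheta₂, ← tsum_mul_left]
  refine tsum_congr fun j => ?_
  have hn' : (n : ℂ) ≠ 0 := by exact_mod_cast hn.ne'
  rw [wterm, jacobiTheta₂_term, eval_one, one_mul, ← Complex.exp_add]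
  congr 1
  have hI : Complex.I ^ 2 = -1 := Complex.I_sq
  field_simp
  linear_combination (-(2 * n * p * a + 2 * n * j * (n * a + p) + n ^ 2 * j ^ 2 : ℂ)) * hI

theorem wfun_one_mem {n : ℕ} (hn : 0 < n) (p : ℤ) : wfun n p 1 ∈ smoothFun := by
  change ContDiff ℝ ∞ (fun q : ℝ × ℝ × ℝ => wsum n p 1 q.1 q.2.1 q.2.2)
  simp only [wsum_one hn]
  have ha : ContDiff ℝ ∞ fun q : ℝ × ℝ × ℝ => (q.1 : ℂ) :=
    Complex.ofRealCLM.contDiff.comp contDiff_fst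
  have hb : ContDiff ℝ ∞ fun q : ℝ × ℝ × ℝ => (q.2.1 : ℂ) :=
    Complex.ofRealCLM.contDiff.comp (contDiff_fst.comp contDiff_snd)
  have hc : ContDiff ℝ ∞ fun q : ℝ × ℝ × ℝ => (q.2.2 : ℂ) :=
    Complex.ofRealCLM.contDiff.comp (contDiff_snd.comp contDiff_snd)
  have hθ : ContDiff ℝ ∞ fun z : ℂ => jacobiTheta₂ z (Complex.I * n) := by
    have hτ : 0 < (Complex.I * n).im := by simpa using hn
    have : Differentiable ℂ fun z : ℂ => jacobiTheta₂ z (Complex.I * n) :=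
      fun z => differentiableAt_jacobiTheta₂_fst z hτ
    exact this.contDiff.restrict_scalars ℝ
  have hz : ContDiff ℝ ∞ fun q : ℝ × ℝ × ℝ => (q.2.1 + Complex.I * q.1 : ℂ) :=
    hb.add (contDiff_const.mul ha)
  refine ContDiff.mul (ContDiff.cexp ?_) (hθ.comp ((contDiff_const.mul hz).add contDiff_const))
  exact (((contDiff_const.mul (ha.pow 2)).neg).sub contDiff_const).add
    (contDiff_const.mul ((contDiff_const.mul hz).add (contDiff_const.mul hc)))

theorem wfun_X_mul {n : ℕ} (hn : 0 < n) (p : ℤ) (P : ℂ[X]) :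
    wfun n p (X * P) = (2 * Real.pi * Complex.I * n : ℂ)⁻¹ • fieldB (wfun n p P) := by
  rw [fieldB_wfun hn, symB, wfun_C_mul, smul_smul, inv_mul_cancel₀, one_smul]
  have : (n : ℂ) ≠ 0 := by exact_mod_cast hn.ne'
  simp [Real.pi_ne_zero, this]

/-- Multiplying the symbol by `X` is, up to a nonzero constant, applying `B_M`, which preserves
smoothness; so the case `P = 1` suffices. -/
theorem wfun_mem {n : ℕ} (hn : 0 < n) (p : ℤ) (P : ℂ[X]) : wfun n p P ∈ smoothFun := by
  induction P using Polynomial.induction_on' with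
  | add P Q hP hQ =>
    rw [wfun_add hn]
    exact smoothFun.add_mem hP hQ
  | monomial k z =>
    rw [← C_mul_X_pow_eq_monomial, wfun_C_mul]
    refine smoothFun.smul_mem _ ?_
    induction k with
    | zero => simpa using wfun_one_mem hn p
    | succ k ih =>
      rw [pow_succ', wfun_X_mul hn]
      exact smoothFun.smul_mem _ (fieldB_mem ih)

/-- The Weil–Brezin transform of `P(x) exp (-π n x²)`, as an element of `C^∞(M)`. -/
def weilBrezin {n : ℕ} (hn : 0 < n) (p : ℤ) (P : ℂ[X]) : smoothFun := ⟨wfun n p P, wfun_mem hn p P⟩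

theorem subLaplacian_weilBrezin {n : ℕ} (hn : 0 < n) (p : ℤ) (P : ℂ[X]) :
    subLaplacianSmooth (weilBrezin hn p P) =
      weilBrezin hn p (-(symA n (symA n P) + symB n (symB n P))) := by
  have hneg : ∀ Q : ℂ[X], wfun n p (-Q) = -wfun n p Q := fun Q => by
    have := wfun_C_mul n p (-1) Q
    simpa using this
  refine Subtype.ext ?_
  change -(fieldA (fieldA (wfun n p P)) + fieldB (fieldB (wfun n p P))) = wfun n p _
  rw [hneg, wfun_add hn, fieldA_wfun hn, fieldA_wfun hn, fieldB_wfun hn, fieldB_wfun hn]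

/-- Hermite polynomials, normalized for the weight `exp (-2 π n x²)`. -/
def hermitePoly (n : ℕ) : ℕ → ℂ[X]
  | 0 => 1
  | k + 1 => derivative (hermitePoly n k) - C (4 * Real.pi * n : ℂ) * (X * hermitePoly n k)

/-- The lowering relation; with the raising recursion that defines the polynomials it yields
Hermite's equation. -/
theorem derivative_hermitePoly (n k : ℕ) : derivative (hermitePoly n (k + 1)) =
    -(C (4 * Real.pi * n * (k + 1) : ℂ) * hermitePoly n k) := by
  induction k with
  | zero =>
    simp [hermitePoly]
  | succ k ih =>
    rw [hermitePoly, ih]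
    simp only [derivative_sub, derivative_neg, derivative_mul, derivative_X, derivative_C, ih]
    have h3 : derivative (hermitePoly n k) =
        hermitePoly n (k + 1) + C (4 * Real.pi * n : ℂ) * (X * hermitePoly n k) := by
      rw [hermitePoly]; ring
    rw [h3]
    simp only [map_mul, map_add, Nat.cast_add, Nat.cast_one, map_one]
    ring

theorem symbol_hermitePoly (n k : ℕ) :
    -(symA n (symA n (hermitePoly n k)) + symB n (symB n (hermitePoly n k))) =
      C (2 * Real.pi * n * (2 * k + 1) : ℂ) * hermitePoly n k := by
  have hI : (C Complex.I : ℂ[X]) ^ 2 = -1 := by rw [← C_pow, Complex.I_sq]; simp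
  -- Hermite's equation. In the full symbol the potential `(2πnx)²` from `B²` cancels the one from
  -- differentiating the Gaussian twice, which adds `2πn` to the eigenvalue.
  have key : -(derivative (derivative (hermitePoly n k))) +
      C (4 * Real.pi * n : ℂ) * (X * derivative (hermitePoly n k)) =
      C (4 * Real.pi * n * k : ℂ) * hermitePoly n k := by
    cases k with
    | zero => simp [hermitePoly]
    | succ k =>
      have h := derivative_hermitePoly n k
      have h3 : derivative (hermitePoly n k) =
          hermitePoly n (k + 1) + C (4 * Real.pi * n : ℂ) * (X * hermitePoly n k) := by
        rw [hermitePoly]; ring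
      rw [h]
      simp only [derivative_neg, derivative_C_mul, h3]
      push_cast
      simp only [map_mul, map_add, map_one]
      ring
  simp only [symA, symB, derivative_sub, derivative_mul, derivative_X, derivative_C]
  simp only [map_mul, map_add, map_one] at key ⊢
  have h4 : (C (4 : ℂ) : ℂ[X]) = 2 * C 2 := by
    rw [show (4 : ℂ) = 2 * 2 by norm_num, C_mul]; rfl
  have h2 : (C (2 : ℂ) : ℂ[X]) = 2 := rfl
  rw [h4, h2] at key
  rw [h2]
  linear_combination key - (2 * C (Real.pi : ℂ) * C (n : ℂ) * X) ^ 2 * hermitePoly n k * hI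

theorem subLaplacian_hermite {n : ℕ} (hn : 0 < n) (p : ℤ) (k : ℕ) :
    subLaplacianSmooth (weilBrezin hn p (hermitePoly n k)) =
      ((2 * Real.pi * n * (2 * k + 1) : ℝ) : ℂ) • weilBrezin hn p (hermitePoly n k) := by
  rw [subLaplacian_weilBrezin, symbol_hermitePoly]
  refine Subtype.ext ?_
  change wfun n p _ = _ • wfun n p _
  rw [wfun_C_mul]
  push_cast
  rfl

end HeisNil
end

noncomputable section
namespace HeisNil
open Polynomial

/-! ### Uniqueness theorems for Fourier coefficients and moments -/

/-- The character `t ↦ exp (2 π i t)`. -/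
def ex (t : ℝ) : ℂ := Complex.exp (2 * Real.pi * Complex.I * t)

theorem norm_ex (t : ℝ) : ‖ex t‖ = 1 := by
  have : 2 * Real.pi * Complex.I * t = ((2 * Real.pi * t : ℝ) : ℂ) * Complex.I := by
    push_cast; ring
  rw [ex, this, Complex.norm_exp_ofReal_mul_I]

theorem ex_add (s t : ℝ) : ex (s + t) = ex s * ex t := by
  rw [ex, ex, ex, ← Complex.exp_add]
  congr 1
  push_cast
  ring

theorem conj_ex (t : ℝ) : (starRingEnd ℂ) (ex t) = ex (-t) := by
  rw [ex, ex, ← Complex.exp_conj]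
  simp [map_ofNat (starRingEnd ℂ) 2]

@[fun_prop]
theorem continuous_ex : Continuous ex := by
  unfold ex
  fun_prop

theorem _root_.MeasureTheory.Integrable.ex_mul {α : Type*} [MeasurableSpace α] {μ : Measure α}
    {f : α → ℂ} (hf : Integrable f μ) {φ : α → ℝ} (hφ : AEMeasurable φ μ) :
    Integrable (fun x => ex (φ x) * f x) μ :=
  hf.bdd_mul (c := 1) (continuous_ex.measurable.comp_aemeasurable hφ).aestronglyMeasurable
    (Filter.Eventually.of_forall fun _ => (norm_ex _).le)

/-- Trigonometric polynomials are uniformly dense in the continuous functions on the circle, so `g`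
integrates to zero against all of these. -/
theorem ae_eq_zero_of_fourier_unitVol {g : ℝ → ℂ} (hg : Integrable g unitVol)
    (h : ∀ m : ℤ, ∫ x, ex (m * x) * g x ∂unitVol = 0) : g =ᵐ[unitVol] 0 := by
  have hmeas : Measurable fun x : ℝ => (x : AddCircle (1 : ℝ)) := AddCircle.measurable_mk'
  have hint : ∀ φ : C(AddCircle (1 : ℝ), ℂ), Integrable (fun x : ℝ => φ x * g x) unitVol := fun φ =>
    hg.bdd_mul (c := ‖φ‖) (φ.continuous.measurable.comp hmeas).aestronglyMeasurable
      (Filter.Eventually.of_forall fun _ => φ.norm_coe_le_norm _)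
  let ℓ : C(AddCircle (1 : ℝ), ℂ) →ₗ[ℂ] ℂ :=
    { toFun := fun φ => ∫ x : ℝ, φ x * g x ∂unitVol
      map_add' := fun φ ψ => by
        rw [← integral_add (hint φ) (hint ψ)]
        simp only [ContinuousMap.add_apply, add_mul]
      map_smul' := fun z φ => by
        simp only [ContinuousMap.smul_apply, smul_eq_mul, mul_assoc, RingHom.id_apply]
        exact integral_const_mul _ _ }
  let ℓc : C(AddCircle (1 : ℝ), ℂ) →L[ℂ] ℂ := ℓ.mkContinuous (∫ x, ‖g x‖ ∂unitVol) fun φ => by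
    refine (norm_integral_le_integral_norm _).trans ?_
    rw [mul_comm, ← integral_const_mul]
    refine integral_mono (hint φ).norm (hg.norm.const_mul _) fun x => ?_
    simp only [norm_mul]
    gcongr
    exact φ.norm_coe_le_norm _
  have hker : (⊤ : Submodule ℂ C(AddCircle (1 : ℝ), ℂ)) ≤ LinearMap.ker ℓc.toLinearMap := by
    rw [← span_fourier_closure_eq_top (T := 1)]
    refine Submodule.topologicalClosure_minimal _ (Submodule.span_le.2 ?_) ℓc.isClosed_ker
    rintro _ ⟨m, rfl⟩
    change ∫ x : ℝ, fourier m (x : AddCircle (1 : ℝ)) * g x ∂unitVol = 0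
    rw [← h m]
    refine integral_congr_ae (Filter.Eventually.of_forall fun x => ?_)
    simp only [fourier_coe_apply, ex]
    congr 2
    push_cast
    ring
  have h1 := IsOpen.ae_eq_zero_of_integral_contDiff_smul_eq_zero (μ := unitVol) (f := g)
    (isOpen_Ioo (a := (0 : ℝ)) (b := 1)) (hg.locallyIntegrable.locallyIntegrableOn _)
    (fun φ hφ _ hsupp => by
      have h0 : ∀ x : ℝ, x ∉ Ioo (0 : ℝ) 1 → φ x = 0 := fun x hx =>
        image_eq_zero_of_notMem_tsupport fun h => hx (hsupp h)
      -- A test function supported in the open interval vanishes at both ends, hence closes up on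
      -- the circle.
      have hcont : Continuous (AddCircle.liftIco (1 : ℝ) 0 fun x => (φ x : ℂ)) := by
        refine AddCircle.liftIco_zero_continuous ?_
          (Complex.continuous_ofReal.comp hφ.continuous).continuousOn
        rw [h0 0 (by simp), h0 1 (by simp)]
      have h2 : ∫ x : ℝ, (⟨_, hcont⟩ : C(AddCircle (1 : ℝ), ℂ)) x * g x ∂unitVol = 0 :=
        LinearMap.mem_ker.1 (hker (Submodule.mem_top (x := (⟨_, hcont⟩ : C(AddCircle (1 : ℝ), ℂ)))))
      rw [← h2]
      refine setIntegral_congr_fun measurableSet_Ico fun x hx => ?_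
      simp only [ContinuousMap.coe_mk]
      rw [AddCircle.liftIco_zero_coe_apply hx, Complex.real_smul])
  have h3 : ∀ᵐ x ∂unitVol, x ∈ Ioo (0 : ℝ) 1 := by
    rw [unitVol, ← Measure.restrict_congr_set Ioo_ae_eq_Ico]
    exact ae_restrict_mem measurableSet_Ioo
  filter_upwards [h1, h3] with x hx hx'
  exact hx hx'

-- Each test function is the Fourier transform of a Schwartz function, and the transform can be
-- moved across the pairing onto `G`.
open FourierTransform in
theorem ae_eq_zero_of_fourier_real {G : ℝ → ℂ} (hG : Integrable G)
    (h : ∀ t : ℝ, ∫ y, ex (t * y) * G y = 0) : ∀ᵐ y, G y = 0 := by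
  have hF : ∀ t : ℝ, 𝓕 G t = 0 := by
    intro t
    rw [Real.fourier_eq', ← h (-t)]
    refine integral_congr_ae (Filter.Eventually.of_forall fun y => ?_)
    simp only [smul_eq_mul, ex]
    congr 2
    simp
    ring
  refine ae_eq_zero_of_integral_contDiff_smul_eq_zero hG.locallyIntegrable fun φ hφ hc => ?_
  have hc' : HasCompactSupport fun x => (φ x : ℂ) := hc.comp_left Complex.ofReal_zero
  let ψ : SchwartzMap ℝ ℂ := hc'.toSchwartzMap (Complex.ofRealCLM.contDiff.comp hφ)
  let ψ' : SchwartzMap ℝ ℂ := 𝓕⁻ ψ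
  have h1 := VectorFourier.integral_fourierIntegral_smul_eq_flip (μ := volume) (ν := volume)
    (L := innerₗ ℝ) Real.continuous_fourierChar continuous_inner ψ'.integrable hG
  have h2 : ∀ y : ℝ, VectorFourier.fourierIntegral Real.fourierChar volume (innerₗ ℝ) ψ' y =
      ψ y := fun y => by
    change 𝓕 (ψ' : ℝ → ℂ) y = ψ y
    rw [← SchwartzMap.fourier_coe, FourierTransform.fourier_fourierInv_eq]
  have h3 : ∀ y : ℝ, VectorFourier.fourierIntegral Real.fourierChar volume (innerₗ ℝ).flip G y = 0 :=
    fun y => by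
      rw [flip_innerₗ]
      exact hF y
  simp only [h2, h3, smul_zero, integral_zero] at h1
  rw [← h1]
  rfl

/-- Exponential integrability allows `exp(2πity)` to be expanded under the integral, so vanishing
moments force the Fourier transform to vanish. -/
theorem ae_eq_zero_of_moments {G : ℝ → ℂ} (hm : AEStronglyMeasurable G volume)
    (hG : ∀ R : ℝ, Integrable fun y => Real.exp (R * |y|) * ‖G y‖)
    (h : ∀ k : ℕ, ∫ y : ℝ, (y : ℂ) ^ k * G y = 0) : ∀ᵐ y, G y = 0 := by
  have hG0 : Integrable G := by
    have := hG 0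
    simp only [zero_mul, Real.exp_zero, one_mul] at this
    exact (integrable_norm_iff hm).1 this
  refine ae_eq_zero_of_fourier_real hG0 fun t => ?_
  have hs : ∀ y : ℝ, HasSum (fun k : ℕ => (2 * Real.pi * |t| * |y|) ^ k / k.factorial)
      (Real.exp (2 * Real.pi * |t| * |y|)) := fun y => by
    rw [Real.exp_eq_exp_ℝ]
    exact NormedSpace.expSeries_div_hasSum_exp _
  have h1 := hasSum_integral_of_dominated_convergence (μ := volume)
    (F := fun (k : ℕ) (y : ℝ) => ((2 * Real.pi * Complex.I * t) ^ k / k.factorial : ℂ) *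
      ((y : ℂ) ^ k * G y))
    (f := fun y => ex (t * y) * G y)
    (fun k y => (2 * Real.pi * |t| * |y|) ^ k / k.factorial * ‖G y‖)
    (fun k => ((Complex.continuous_ofReal.pow k).aestronglyMeasurable.mul hm).const_mul _)
    (fun k => Filter.Eventually.of_forall fun y => le_of_eq (by
      simp [abs_of_pos Real.pi_pos]
      ring))
    (Filter.Eventually.of_forall fun y => ((hs y).mul_right _).summable)
    (by
      simp_rw [fun y => ((hs y).mul_right ‖G y‖).tsum_eq]
      exact hG _)
    (Filter.Eventually.of_forall fun y => by
      have h2 : HasSum (fun k : ℕ => (2 * Real.pi * Complex.I * t * y : ℂ) ^ k / k.factorial)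
          (ex (t * y)) := by
        have := NormedSpace.expSeries_div_hasSum_exp (𝔸 := ℂ) (2 * Real.pi * Complex.I * t * y : ℂ)
        rw [← Complex.exp_eq_exp_ℂ] at this
        have hz : (2 * Real.pi * Complex.I * t * y : ℂ) =
            2 * Real.pi * Complex.I * ((t * y : ℝ) : ℂ) := by push_cast; ring
        rw [ex, ← hz]
        exact this
      refine (h2.mul_right (G y)).congr_fun fun k => ?_
      ring)
  simp only [integral_const_mul, h, mul_zero] at h1
  exact (hasSum_zero.unique h1).symm

/-! ### Unfolding integrals over the line into unit intervals. -/

theorem measurePreserving_add_int (j : ℤ) :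
    MeasurePreserving (fun a : ℝ => a + j) unitVol (volume.restrict (Ico (j : ℝ) (j + 1))) := by
  have := (measurePreserving_add_right volume (j : ℝ)).restrict_preimage
    (measurableSet_Ico (a := (j : ℝ)) (b := j + 1))
  rw [preimage_add_const_Ico, sub_self, add_sub_cancel_left] at this
  exact this

theorem measurableEmbedding_add (j : ℤ) : MeasurableEmbedding fun a : ℝ => a + j :=
  (MeasurableEquiv.addRight (j : ℝ)).measurableEmbedding

theorem integrable_of_shifts {w : ℝ → ℂ} (h : ∀ j : ℤ, Integrable (fun a => w (a + j)) unitVol)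
    (hs : Summable fun j : ℤ => ∫ a, ‖w (a + j)‖ ∂unitVol) : Integrable w := by
  rw [← integrableOn_univ, ← iUnion_Ico_intCast ℝ]
  refine integrableOn_iUnion_of_summable_integral_norm (fun j => ?_) ?_
  · exact ((measurePreserving_add_int j).integrable_comp_emb (measurableEmbedding_add j)).1 (h j)
  · refine hs.congr fun j => ?_
    exact ((measurePreserving_add_int j).integral_comp (measurableEmbedding_add j)
      (fun y => ‖w y‖))

theorem hasSum_shifts {w : ℝ → ℂ} (hw : Integrable w) :
    HasSum (fun j : ℤ => ∫ a, w (a + j) ∂unitVol) (∫ y, w y) := by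
  have h := hasSum_integral_iUnion (f := w) (μ := volume) (s := fun j : ℤ => Ico (j : ℝ) (j + 1))
    (fun j => measurableSet_Ico) (pairwise_disjoint_Ico_intCast ℝ) hw.integrableOn
  rw [iUnion_Ico_intCast, setIntegral_univ] at h
  refine h.congr_fun ?_
  intro j
  exact (measurePreserving_add_int j).integral_comp (measurableEmbedding_add j) w

theorem ae_eq_zero_prod {α β : Type*} [MeasurableSpace α] [MeasurableSpace β] {μ : Measure α}
    {ν : Measure β} [SFinite μ] [SFinite ν] {f : α × β → ℂ} (hf : Integrable f (μ.prod ν))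
    (h : ∀ᵐ x ∂μ, ∀ᵐ y ∂ν, f (x, y) = 0) : f =ᵐ[μ.prod ν] 0 := by
  have h1 : ∫ z, ‖f z‖ ∂(μ.prod ν) = 0 := by
    rw [integral_prod _ hf.norm]
    refine integral_eq_zero_of_ae ?_
    filter_upwards [h] with x hx
    refine integral_eq_zero_of_ae ?_
    filter_upwards [hx] with y hy
    simp [hy]
  rw [integral_eq_zero_iff_of_nonneg (fun z => norm_nonneg _) hf.norm] at h1
  filter_upwards [h1] with z hz
  exact norm_eq_zero.1 hz

/-- The Fourier coefficients of `V` in the variables `b` and `c`. -/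
def coeffBC (V : ℝ × ℝ × ℝ → ℂ) (n q : ℤ) (a : ℝ) : ℂ :=
  ∫ y, ex (q * y.1 + n * y.2) * V (a, y) ∂(unitVol.prod unitVol)

/-- One-dimensional uniqueness in `b`, then in `c`; countability of the frequencies gives a common
null set of `b`. -/
theorem ae_eq_zero_of_fourier_unitVol₂ {h : ℝ × ℝ → ℂ} (hh : Integrable h (unitVol.prod unitVol))
    (h0 : ∀ n q : ℤ, ∫ y, ex (q * y.1 + n * y.2) * h y ∂(unitVol.prod unitVol) = 0) :
    h =ᵐ[unitVol.prod unitVol] 0 := by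
  have hi : ∀ n : ℤ, Integrable (fun y : ℝ × ℝ => ex (n * y.2) * h y) (unitVol.prod unitVol) :=
    fun n => hh.ex_mul (by fun_prop)
  have h1 : ∀ n : ℤ, (fun b => ∫ c, ex (n * c) * h (b, c) ∂unitVol) =ᵐ[unitVol] 0 := by
    intro n
    refine ae_eq_zero_of_fourier_unitVol (hi n).integral_prod_left fun q => ?_
    rw [← h0 n q, integral_prod _ (hh.ex_mul (by fun_prop))]
    refine integral_congr_ae (Filter.Eventually.of_forall fun b => ?_)
    simp only
    rw [← integral_const_mul]
    refine integral_congr_ae (Filter.Eventually.of_forall fun c => ?_)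
    simp only [ex_add]
    ring
  refine ae_eq_zero_prod hh ?_
  filter_upwards [ae_all_iff.2 h1, hh.prod_right_ae] with b hb hb'
  exact ae_eq_zero_of_fourier_unitVol hb' hb

theorem ae_eq_zero_of_coeffBC {V : ℝ × ℝ × ℝ → ℂ}
    (hV : Integrable V (unitVol.prod (unitVol.prod unitVol)))
    (h : ∀ n q : ℤ, coeffBC V n q =ᵐ[unitVol] 0) :
    V =ᵐ[unitVol.prod (unitVol.prod unitVol)] 0 := by
  refine ae_eq_zero_prod hV ?_
  filter_upwards [ae_all_iff.2 fun n => ae_all_iff.2 (h n), hV.prod_right_ae] with a ha ha'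
  exact ae_eq_zero_of_fourier_unitVol₂ ha' ha

end HeisNil
end

noncomputable section
namespace HeisNil
open Polynomial

/-! ### Completeness of the eigenfunctions -/

/-- The Fourier coefficients of a Weil–Brezin series, as a function on the line. -/
def wcoef (n : ℕ) (p : ℤ) (P : ℂ[X]) (y : ℝ) : ℂ :=
  P.eval ((y + p / n : ℝ) : ℂ) * (Real.exp (-Real.pi * n * (y + p / n) ^ 2) : ℂ)

theorem wterm_eq (n : ℕ) (p : ℤ) (P : ℂ[X]) (a b c : ℝ) (j : ℤ) :
    wterm n p P a b c j =
      wcoef n p P (a + j) * ex (((n * j + p : ℤ) : ℝ) * b + ((n : ℤ) : ℝ) * c) := by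
  rw [wterm, wcoef, ex, mul_assoc (P.eval _), Complex.ofReal_exp, ← Complex.exp_add]
  congr 2
  push_cast
  ring

@[fun_prop]
theorem continuous_wcoef (n : ℕ) (p : ℤ) (P : ℂ[X]) : Continuous (wcoef n p P) := by
  unfold wcoef
  fun_prop

theorem integrable_wterm_mul {n : ℕ} (hn : 0 < n) (p : ℤ) (P : ℂ[X]) {V : ℝ × ℝ × ℝ → ℂ}
    (hV : Integrable V (unitVol.prod (unitVol.prod unitVol))) :
    ∃ D : ℝ, ∀ j, Integrable (fun q : ℝ × ℝ × ℝ => wterm n p P q.1 q.2.1 q.2.2 j * V q)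
        (unitVol.prod (unitVol.prod unitVol)) ∧
      ∫ q : ℝ × ℝ × ℝ, ‖wterm n p P q.1 q.2.1 q.2.2 j * V q‖
        ∂(unitVol.prod (unitVol.prod unitVol)) ≤ D * Real.exp (-|(j : ℝ)|) := by
  obtain ⟨C, hC, h⟩ := wterm_bound hn p P
  have hae : ∀ᵐ q ∂(unitVol.prod (unitVol.prod unitVol)), q ∈ cube := by
    rw [← volume_restrict_cube]
    exact ae_restrict_mem (measurableSet_Ico.prod (measurableSet_Ico.prod measurableSet_Ico))
  have hbound : ∀ j : ℤ, ∀ᵐ q ∂(unitVol.prod (unitVol.prod unitVol)),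
      ‖wterm n p P q.1 q.2.1 q.2.2 j‖ ≤ C * Real.exp 1 * Real.exp (-|(j : ℝ)|) := fun j => by
    filter_upwards [hae] with q hq
    refine (h _ _ _ _).trans ?_
    gcongr
    exact abs_le.2 ⟨by linarith [hq.1.1], hq.1.2.le⟩
  have hint : ∀ j : ℤ, Integrable (fun q : ℝ × ℝ × ℝ => wterm n p P q.1 q.2.1 q.2.2 j * V q)
      (unitVol.prod (unitVol.prod unitVol)) := fun j => by
    refine hV.bdd_mul (Continuous.aestronglyMeasurable ?_) (hbound j)
    simp only [wterm_eq]
    fun_prop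
  refine ⟨C * Real.exp 1 * ∫ q, ‖V q‖ ∂(unitVol.prod (unitVol.prod unitVol)), fun j =>
    ⟨hint j, ?_⟩⟩
  calc _ ≤ ∫ q, C * Real.exp 1 * Real.exp (-|(j : ℝ)|) * ‖V q‖
        ∂(unitVol.prod (unitVol.prod unitVol)) := by
        refine integral_mono_ae (hint j).norm (hV.norm.const_mul _) ?_
        filter_upwards [hbound j] with q hq
        rw [norm_mul]
        gcongr
    _ = _ := by rw [integral_const_mul]; ring

/-- The `j`-th term has the single frequency `(nj+p, n)` in `(b, c)`, so integrating these variables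
selects one coefficient of `V`. -/
theorem integral_wterm_mul {n : ℕ} (hn : 0 < n) (p : ℤ) (P : ℂ[X]) {V : ℝ × ℝ × ℝ → ℂ}
    (hV : Integrable V (unitVol.prod (unitVol.prod unitVol))) (j : ℤ) :
    ∫ q : ℝ × ℝ × ℝ, wterm n p P q.1 q.2.1 q.2.2 j * V q ∂(unitVol.prod (unitVol.prod unitVol)) =
      ∫ a, wcoef n p P (a + j) * coeffBC V n (n * j + p) a ∂unitVol := by
  obtain ⟨D, hD⟩ := integrable_wterm_mul hn p P hV
  rw [integral_prod _ (hD j).1]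
  refine integral_congr_ae (Filter.Eventually.of_forall fun a => ?_)
  simp only [wterm_eq, coeffBC, mul_assoc]
  rw [integral_const_mul]

theorem hasSum_integral_wsum_mul {n : ℕ} (hn : 0 < n) (p : ℤ) (P : ℂ[X]) {V : ℝ × ℝ × ℝ → ℂ}
    (hV : Integrable V (unitVol.prod (unitVol.prod unitVol))) :
    HasSum (fun j : ℤ => ∫ a, wcoef n p P (a + j) * coeffBC V n (n * j + p) a ∂unitVol)
      (∫ q : ℝ × ℝ × ℝ, wsum n p P q.1 q.2.1 q.2.2 * V q
        ∂(unitVol.prod (unitVol.prod unitVol))) := by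
  obtain ⟨D, hD⟩ := integrable_wterm_mul hn p P hV
  have h := hasSum_integral_of_summable_integral_norm (fun j => (hD j).1)
    (Summable.of_nonneg_of_le (fun j => integral_nonneg fun q => norm_nonneg _)
      (fun j => (hD j).2) (summable_exp_neg_abs_int.mul_left D))
  simp only [integral_wterm_mul hn p P hV, tsum_mul_right] at h
  exact h

theorem integrable_wsum_mul {n : ℕ} (hn : 0 < n) (p : ℤ) (P : ℂ[X]) {V : ℝ × ℝ × ℝ → ℂ}
    (hV : Integrable V (unitVol.prod (unitVol.prod unitVol))) :
    Integrable (fun q : ℝ × ℝ × ℝ => wsum n p P q.1 q.2.1 q.2.2 * V q)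
      (unitVol.prod (unitVol.prod unitVol)) := by
  have h1 := memLp_of_smooth (wfun_mem hn p P) ⊤
  have h2 : MemLp (fun q => wfun n p P (nilCoord q)) ⊤ (unitVol.prod (unitVol.prod unitVol)) :=
    h1.comp_measurePreserving measurePreserving_nilCoord
  exact (memLp_one_iff_integrable.2 hV).mul (r := 1) h2 |> memLp_one_iff_integrable.1

/-- Pairing with the Weil–Brezin series, as a linear functional of the symbol. -/
def weilPairing {n : ℕ} (hn : 0 < n) (p : ℤ) {V : ℝ × ℝ × ℝ → ℂ}
    (hV : Integrable V (unitVol.prod (unitVol.prod unitVol))) : ℂ[X] →ₗ[ℂ] ℂ where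
  toFun P := ∫ q : ℝ × ℝ × ℝ, wsum n p P q.1 q.2.1 q.2.2 * V q ∂(unitVol.prod (unitVol.prod unitVol))
  map_add' P Q := by
    rw [← integral_add (integrable_wsum_mul hn p P hV) (integrable_wsum_mul hn p Q hV)]
    refine integral_congr_ae (Filter.Eventually.of_forall fun q => ?_)
    have := congrFun (wfun_add hn p P Q) (nilCoord q)
    simp only [← add_mul]
    congr 1
  map_smul' z P := by
    simp only [RingHom.id_apply, smul_eq_mul, ← integral_const_mul]
    refine integral_congr_ae (Filter.Eventually.of_forall fun q => ?_)
    have := congrFun (wfun_C_mul n p z P) (nilCoord q)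
    simp only [← mul_assoc, smul_eq_C_mul]
    congr 1

/-- Since `X H_k` is a combination of `H_k'` and `H_{k+1}`, and `H_k'` is a multiple of `H_{k-1}`,
induction on `m` kills every `X^m H_k`; `k = 0` gives all monomials. -/
theorem eq_zero_of_hermitePoly {n : ℕ} (hn : 0 < n) (ℓ : ℂ[X] →ₗ[ℂ] ℂ)
    (h : ∀ k, ℓ (hermitePoly n k) = 0) : ℓ = 0 := by
  have hc : (4 * Real.pi * n : ℂ) ≠ 0 := by
    have : (n : ℂ) ≠ 0 := by exact_mod_cast hn.ne'
    simp [Real.pi_ne_zero, this]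
  have h1 : ∀ m k, ℓ (X ^ m * hermitePoly n k) = 0 := by
    intro m
    induction m with
    | zero => simpa using h
    | succ m ih =>
      intro k
      have hd : ℓ (X ^ m * derivative (hermitePoly n k)) = 0 := by
        cases k with
        | zero => simp [hermitePoly]
        | succ k =>
          rw [derivative_hermitePoly, mul_neg, mul_left_comm, ← smul_eq_C_mul, map_neg, map_smul,
            ih, smul_zero, neg_zero]
      have hk := ih (k + 1)
      rw [hermitePoly, mul_sub, mul_left_comm, ← smul_eq_C_mul, map_sub, map_smul, hd, zero_sub,
        neg_eq_zero, smul_eq_zero] at hk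
      rw [pow_succ, mul_assoc]
      exact hk.resolve_left hc
  refine LinearMap.ext fun P => ?_
  induction P using Polynomial.induction_on' with
  | add P Q hP hQ => rw [map_add, hP, hQ]; simp
  | monomial k z =>
    have := h1 k 0
    rw [hermitePoly, mul_one] at this
    rw [← C_mul_X_pow_eq_monomial, ← smul_eq_C_mul, map_smul, this]
    simp

theorem gauss_exp_bound {n : ℕ} (hn : 0 < n) (s R : ℝ) : ∃ C : ℝ, 0 ≤ C ∧ ∀ y : ℝ,
    Real.exp (R * |y|) * Real.exp (-Real.pi * n * (y + s) ^ 2) ≤ C * Real.exp (-|y|) := by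
  refine ⟨Real.exp (s ^ 2 + (R + 1) ^ 2 / 2), by positivity, fun y => ?_⟩
  rw [← Real.exp_add, ← Real.exp_add]
  refine Real.exp_le_exp.2 ?_
  have hn' : (1 : ℝ) ≤ n := by exact_mod_cast hn
  have h1 : (1 : ℝ) ≤ Real.pi * n := by nlinarith [Real.pi_gt_three]
  nlinarith [mul_nonneg (sub_nonneg.2 h1) (sq_nonneg (y + s)), sq_nonneg (y + 2 * s), sq_nonneg (|y| - (R + 1)), sq_abs y]

theorem norm_coeffBC_le (V : ℝ × ℝ × ℝ → ℂ) (n q : ℤ) (a : ℝ) :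
    ‖coeffBC V n q a‖ ≤ ∫ y, ‖V (a, y)‖ ∂(unitVol.prod unitVol) := by
  refine (norm_integral_le_integral_norm _).trans (le_of_eq ?_)
  simp only [norm_mul, norm_ex, one_mul]

theorem integrable_coeffBC {V : ℝ × ℝ × ℝ → ℂ}
    (hV : Integrable V (unitVol.prod (unitVol.prod unitVol))) (n q : ℤ) :
    Integrable (coeffBC V n q) unitVol :=
  (hV.ex_mul (φ := fun x => q * x.2.1 + n * x.2.2) (by fun_prop)).integral_prod_left

/-- For fixed `n` and `p`, the coefficients of frequencies `nj + p`, laid on the successive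
intervals `[j, j+1)`, form one function on the line. Orthogonality to the Hermite series says that
this function, times a Gaussian, has all moments zero; so it vanishes. -/
theorem coeffBC_eq_zero {n : ℕ} (hn : 0 < n) (p : ℤ) {V : ℝ × ℝ × ℝ → ℂ}
    (hV : Integrable V (unitVol.prod (unitVol.prod unitVol)))
    (h : ∀ k, ∫ q : ℝ × ℝ × ℝ, wsum n p (hermitePoly n k) q.1 q.2.1 q.2.2 * V q
      ∂(unitVol.prod (unitVol.prod unitVol)) = 0) (j : ℤ) :
    coeffBC V n (n * j + p) =ᵐ[unitVol] 0 := by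
  have hpair : ∀ P : ℂ[X], HasSum
      (fun j : ℤ => ∫ a, wcoef n p P (a + j) * coeffBC V n (n * j + p) a ∂unitVol) 0 := fun P => by
    have h1 := hasSum_integral_wsum_mul hn p P hV
    have h2 : ∫ q : ℝ × ℝ × ℝ, wsum n p P q.1 q.2.1 q.2.2 * V q
        ∂(unitVol.prod (unitVol.prod unitVol)) = 0 :=
      LinearMap.congr_fun (eq_zero_of_hermitePoly hn (weilPairing hn p hV) h) P
    rw [h2] at h1
    exact h1
  set g : ℝ → ℂ := wcoef n p 1 with hg
  -- `⌊y⌋` recovers the index `j` and the fractional part recovers `a`.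
  let G : ℝ → ℂ := fun y => g y * coeffBC V n (n * ⌊y⌋ + p) (Int.fract y)
  let K : ℝ → ℝ := fun a => ∫ y, ‖V (a, y)‖ ∂(unitVol.prod unitVol)
  have hK : Integrable K unitVol := hV.integral_norm_prod_left
  have hK0 : ∀ a, 0 ≤ K a := fun a => integral_nonneg fun y => norm_nonneg _
  have hunit : ∀ᵐ a ∂unitVol, a ∈ Ico (0 : ℝ) 1 := ae_restrict_mem measurableSet_Ico
  have hGshift : ∀ (f : ℝ → ℂ) (j : ℤ), (fun a : ℝ => f (a + j) * G (a + j)) =ᵐ[unitVol]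
      fun a => f (a + j) * (g (a + j) * coeffBC V n (n * j + p) a) := by
    intro f j
    filter_upwards [hunit] with a ha
    have h1 : ⌊a + j⌋ = j := by
      rw [Int.floor_add_intCast, Int.floor_eq_zero_iff.2 ha, zero_add]
    have h2 : Int.fract (a + j) = a := by
      rw [Int.fract_add_intCast, Int.fract_eq_self.2 ha]
    simp only [G, h1, h2]
  have hgn : ∀ y, ‖g y‖ = Real.exp (-Real.pi * n * (y + p / n) ^ 2) := fun y => by
    rw [hg, wcoef, eval_one, one_mul, Complex.norm_real, Real.norm_of_nonneg (Real.exp_nonneg _)]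
  have hint : ∀ f : ℝ → ℂ, Continuous f → (∃ R : ℝ, ∃ D, 0 ≤ D ∧ ∀ y, ‖f y‖ ≤ D * Real.exp (R * |y|)) →
      Integrable fun y => f y * G y := by
    rintro f hf ⟨R, D, hD, hfR⟩
    obtain ⟨C, hC, hCb⟩ := gauss_exp_bound hn (p / n : ℝ) R
    have hbd : ∀ j : ℤ, ∀ᵐ a ∂unitVol, ‖f (a + j) * g (a + j)‖ ≤
        D * C * Real.exp 1 * Real.exp (-|(j : ℝ)|) := fun j => by
      filter_upwards [hunit] with a ha
      rw [norm_mul, hgn]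
      calc _ ≤ D * Real.exp (R * |a + j|) * Real.exp (-Real.pi * n * (a + j + p / n) ^ 2) := by
            gcongr
            exact hfR _
        _ ≤ D * (C * Real.exp (-|a + j|)) := by
            rw [mul_assoc D]
            exact mul_le_mul_of_nonneg_left (hCb _) hD
        _ ≤ D * (C * (Real.exp 1 * Real.exp (-|(j : ℝ)|))) := by
            rw [← Real.exp_add]
            gcongr
            have : |(j : ℝ)| ≤ |a + j| + |a| := by
              calc |(j : ℝ)| = |(a + j) - a| := by congr 1; ring
                _ ≤ _ := abs_sub _ _
            have : |a| ≤ 1 := abs_le.2 ⟨by linarith [ha.1], ha.2.le⟩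
            linarith
        _ = _ := by ring
    have hi : ∀ j : ℤ, Integrable
        (fun a : ℝ => f (a + j) * (g (a + j) * coeffBC V n (n * j + p) a)) unitVol := fun j => by
      simp only [← mul_assoc]
      refine (integrable_coeffBC hV n (n * j + p)).bdd_mul
        (Continuous.aestronglyMeasurable ?_) (hbd j)
      fun_prop
    refine integrable_of_shifts (fun j => (hi j).congr (hGshift f j).symm) ?_
    refine Summable.of_nonneg_of_le (fun j => integral_nonneg fun q => norm_nonneg _) (fun j => ?_)
      (summable_exp_neg_abs_int.mul_left (D * C * Real.exp 1 * ∫ a, K a ∂unitVol))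
    calc ∫ a, ‖f (a + j) * G (a + j)‖ ∂unitVol
        ≤ ∫ a, D * C * Real.exp 1 * Real.exp (-|(j : ℝ)|) * K a ∂unitVol := by
          refine integral_mono_ae ((hi j).congr (hGshift f j).symm).norm (hK.const_mul _) ?_
          filter_upwards [hbd j, hGshift f j] with a ha ha'
          rw [ha', ← mul_assoc, norm_mul]
          gcongr
          exact norm_coeffBC_le _ _ _ _
      _ = _ := by rw [integral_const_mul]; ring
  have hG1 : Integrable G := by
    have := hint (fun _ => 1) continuous_const ⟨0, 1, zero_le_one, fun y => by simp⟩
    simpa using this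
  have hexp : ∀ R : ℝ, Integrable fun y => Real.exp (R * |y|) * ‖G y‖ := fun R => by
    have := (hint (fun y => (Real.exp (R * |y|) : ℂ))
      (Complex.continuous_ofReal.comp (by fun_prop)) ⟨R, 1, zero_le_one, fun y => by
        rw [Complex.norm_real, Real.norm_of_nonneg (Real.exp_nonneg _), one_mul]⟩).norm
    refine this.congr (Filter.Eventually.of_forall fun y => ?_)
    simp only [norm_mul]
    rw [Complex.norm_real, Real.norm_of_nonneg (Real.exp_nonneg _)]
  have hmom : ∀ k : ℕ, ∫ y : ℝ, (y : ℂ) ^ k * G y = 0 := by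
    intro k
    have hk : Integrable fun y : ℝ => (y : ℂ) ^ k * G y := by
      refine hint (fun y => (y : ℂ) ^ k) (by fun_prop) ⟨1, k.factorial, by positivity, fun y => ?_⟩
      rw [norm_pow, Complex.norm_real, Real.norm_eq_abs, one_mul]
      have := Real.pow_div_factorial_le_exp |y| (abs_nonneg y) k
      rw [div_le_iff₀ (by positivity)] at this
      linarith
    -- Symbols are evaluated at `y + p/n`, so `(X - p/n)^k` produces the moment `y^k`.
    refine (hasSum_shifts hk).unique ((hpair ((X - C (p / n : ℂ)) ^ k)).congr_fun fun j => ?_)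
    have hw : ∀ y : ℝ, wcoef n p ((X - C (p / n : ℂ)) ^ k) y = (y : ℂ) ^ k * g y := fun y => by
      rw [hg, wcoef, wcoef]
      simp
    rw [integral_congr_ae (hGshift (fun y => (y : ℂ) ^ k) j)]
    refine integral_congr_ae (Filter.Eventually.of_forall fun a => ?_)
    simp only [hw, mul_assoc]
  have hG := ae_eq_zero_of_moments hG1.1 hexp hmom
  have hGj : ∀ᵐ a ∂unitVol, G (a + j) = 0 :=
    (measurePreserving_add_int j).quasiMeasurePreserving.ae (ae_restrict_of_ae hG)
  filter_upwards [hGj, hGshift (fun _ => 1) j] with a ha ha'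
  simp only [ha, one_mul, mul_zero] at ha'
  have hg0 : g (a + j) ≠ 0 := by
    rw [← norm_pos_iff, hgn]
    exact Real.exp_pos _
  exact (mul_eq_zero.1 ha'.symm).resolve_left hg0

/-- Reduces negative central frequencies to positive ones of the conjugate function. -/
theorem coeffBC_conj (V : ℝ × ℝ × ℝ → ℂ) (n q : ℤ) (a : ℝ) :
    coeffBC V n q a =
      (starRingEnd ℂ) (coeffBC (fun x => (starRingEnd ℂ) (V x)) (-n) (-q) a) := by
  rw [coeffBC, coeffBC, ← integral_conj]
  refine integral_congr_ae (Filter.Eventually.of_forall fun y => ?_)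
  simp only [map_mul, conj_ex, Complex.conj_conj]
  congr 2
  push_cast
  ring

theorem ae_eq_zero_of_orthogonal {V : ℝ × ℝ × ℝ → ℂ}
    (hV : Integrable V (unitVol.prod (unitVol.prod unitVol)))
    (htorus : ∀ m q : ℤ, ∫ x, ex (m * x.1 + q * x.2.1) * V x
      ∂(unitVol.prod (unitVol.prod unitVol)) = 0)
    (hpos : ∀ (n p k : ℕ), p ≤ n → ∫ x : ℝ × ℝ × ℝ,
      wsum (n + 1) p (hermitePoly (n + 1) k) x.1 x.2.1 x.2.2 * V x
      ∂(unitVol.prod (unitVol.prod unitVol)) = 0)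
    (hneg : ∀ (n p k : ℕ), p ≤ n → ∫ x : ℝ × ℝ × ℝ,
      wsum (n + 1) p (hermitePoly (n + 1) k) x.1 x.2.1 x.2.2 * (starRingEnd ℂ) (V x)
      ∂(unitVol.prod (unitVol.prod unitVol)) = 0) :
    V =ᵐ[unitVol.prod (unitVol.prod unitVol)] 0 := by
  have key : ∀ W : ℝ × ℝ × ℝ → ℂ, Integrable W (unitVol.prod (unitVol.prod unitVol)) →
      (∀ (n p k : ℕ), p ≤ n → ∫ x : ℝ × ℝ × ℝ,
        wsum (n + 1) p (hermitePoly (n + 1) k) x.1 x.2.1 x.2.2 * W x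
        ∂(unitVol.prod (unitVol.prod unitVol)) = 0) →
      ∀ (n : ℕ) (q : ℤ), coeffBC W ((n + 1 : ℕ) : ℤ) q =ᵐ[unitVol] 0 := by
    intro W hW hWo n q
    have hpos' : (0 : ℤ) < ((n + 1 : ℕ) : ℤ) := by exact_mod_cast n.succ_pos
    -- Division with remainder by `n + 1` writes `q` as `(n+1)j + p` with `0 ≤ p ≤ n`.
    have h0 := Int.emod_nonneg q hpos'.ne'
    have h1 := Int.emod_lt_of_pos q hpos'
    have hp : ((q % ((n + 1 : ℕ) : ℤ)).toNat : ℤ) = q % ((n + 1 : ℕ) : ℤ) := Int.toNat_of_nonneg h0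
    have h2 := coeffBC_eq_zero n.succ_pos ((q % ((n + 1 : ℕ) : ℤ)).toNat : ℤ) hW
      (fun k => hWo n _ k (by omega)) (q / ((n + 1 : ℕ) : ℤ))
    rw [hp, Nat.succ_eq_add_one, Int.mul_ediv_add_emod] at h2
    exact h2
  have hVc : Integrable (fun x => (starRingEnd ℂ) (V x)) (unitVol.prod (unitVol.prod unitVol)) :=
    Complex.conjCLE.toContinuousLinearMap.integrable_comp hV
  refine ae_eq_zero_of_coeffBC hV fun n q => ?_
  rcases lt_trichotomy n 0 with hn | rfl | hn
  · obtain ⟨m, hm⟩ := Int.eq_ofNat_of_zero_le (show 0 ≤ -n - 1 by omega)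
    have h1 := key _ hVc hneg m (-q)
    filter_upwards [h1] with a ha
    rw [coeffBC_conj, show -n = ((m + 1 : ℕ) : ℤ) by push_cast; omega, ha]
    simp
  · refine ae_eq_zero_of_fourier_unitVol (integrable_coeffBC hV 0 q) fun m => ?_
    rw [← htorus m q, integral_prod _ (hV.ex_mul (by fun_prop))]
    refine integral_congr_ae (Filter.Eventually.of_forall fun a => ?_)
    simp only [coeffBC]
    rw [← integral_const_mul]
    refine integral_congr_ae (Filter.Eventually.of_forall fun y => ?_)
    simp only [ex_add, Int.cast_zero, zero_mul, add_zero]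
    ring
  · obtain ⟨m, hm⟩ := Int.eq_ofNat_of_zero_le (show 0 ≤ n - 1 by omega)
    rw [show n = ((m + 1 : ℕ) : ℤ) by push_cast; omega]
    exact key _ hV hpos m q

end HeisNil
end

noncomputable section
namespace HeisNil

/-! ### The eigenfunctions of the sub-Laplacian -/

theorem ex_int (m : ℤ) : ex m = 1 := by
  rw [ex, show (2 * Real.pi * Complex.I * ((m : ℝ) : ℂ)) = m * (2 * Real.pi * Complex.I) by
    push_cast; ring]
  exact Complex.exp_int_mul_two_pi_mul_I m

theorem hasDerivAt_ex (s r : ℝ) :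
    HasDerivAt (fun t : ℝ => ex (s + r * t)) (2 * Real.pi * Complex.I * r * ex s) 0 := by
  have h1 : HasDerivAt (fun t : ℝ => ((s + r * t : ℝ) : ℂ)) r 0 := by
    simpa using (((hasDerivAt_id (0 : ℝ)).const_mul r).const_add s).ofReal_comp
  have h2 := (h1.const_mul (2 * Real.pi * Complex.I)).cexp
  refine h2.congr_deriv ?_
  simp [ex]
  ring

/-- The function `(a, b, c) ↦ exp (2 π i (m a + q b))`, lifted from the torus. -/
def torusFun (m q : ℤ) : Nil → ℂ :=
  Quotient.lift (fun x : Heis => ex (m * x.a + q * x.b)) (by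
    intro x y h
    obtain ⟨k, l, r, hγ⟩ := QuotientGroup.rightRel_apply.1 h
    have hy : y = ⟨k, l, r⟩ * x := by rw [← hγ]; group
    have h1 : (m * y.a + q * y.b : ℝ) = (m * x.a + q * x.b) + ((m * k + q * l : ℤ) : ℝ) := by
      rw [hy]
      simp only [Heis.mul_a, Heis.mul_b]
      push_cast
      ring
    rw [h1, ex_add (m * x.a + q * x.b) _, ex_int, mul_one])

theorem torusFun_nilCoord (m q : ℤ) (a b c : ℝ) :
    torusFun m q (nilCoord (a, b, c)) = ex (m * a + q * b) := rfl

theorem torusFun_mem (m q : ℤ) : torusFun m q ∈ smoothFun := by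
  change ContDiff ℝ ∞ fun p : ℝ × ℝ × ℝ => ex (m * p.1 + q * p.2.1)
  unfold ex
  refine ContDiff.cexp (contDiff_const.mul (Complex.ofRealCLM.contDiff.comp ?_))
  exact (contDiff_const.mul contDiff_fst).add
    (contDiff_const.mul (contDiff_fst.comp contDiff_snd))

theorem fieldA_torusFun (m q : ℤ) :
    fieldA (torusFun m q) = (2 * Real.pi * Complex.I * m : ℂ) • torusFun m q := by
  refine field_ext fun ⟨a, b, c⟩ => ?_
  simp only [fieldA, rmul_a_nilCoord, torusFun_nilCoord, Pi.smul_apply, smul_eq_mul]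
  have h := (hasDerivAt_ex (m * a + q * b) m).deriv
  rw [Complex.ofReal_intCast] at h
  rw [← h]
  congr 1
  funext t
  ring_nf

theorem fieldB_torusFun (m q : ℤ) :
    fieldB (torusFun m q) = (2 * Real.pi * Complex.I * q : ℂ) • torusFun m q := by
  refine field_ext fun ⟨a, b, c⟩ => ?_
  simp only [fieldB, rmul_b_nilCoord, torusFun_nilCoord, Pi.smul_apply, smul_eq_mul]
  have h := (hasDerivAt_ex (m * a + q * b) q).deriv
  rw [Complex.ofReal_intCast] at h
  rw [← h]
  congr 1
  funext t
  ring_nf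

theorem subLaplacian_torusFun (m q : ℤ) :
    subLaplacianSmooth ⟨torusFun m q, torusFun_mem m q⟩ =
      (((2 * Real.pi) ^ 2 * (m ^ 2 + q ^ 2) : ℝ) : ℂ) •
        (⟨torusFun m q, torusFun_mem m q⟩ : smoothFun) := by
  have hA : opA ⟨torusFun m q, torusFun_mem m q⟩ =
      (2 * Real.pi * Complex.I * m : ℂ) • (⟨torusFun m q, torusFun_mem m q⟩ : smoothFun) :=
    Subtype.ext (fieldA_torusFun m q)
  have hB : opB ⟨torusFun m q, torusFun_mem m q⟩ =
      (2 * Real.pi * Complex.I * q : ℂ) • (⟨torusFun m q, torusFun_mem m q⟩ : smoothFun) :=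
    Subtype.ext (fieldB_torusFun m q)
  simp only [subLaplacianSmooth, LinearMap.neg_apply, LinearMap.add_apply, LinearMap.comp_apply,
    hA, hB, map_smul, smul_smul, ← add_smul, ← neg_smul]
  congr 1
  push_cast
  linear_combination (-(2 * Real.pi : ℂ) ^ 2 * (m ^ 2 + q ^ 2)) * Complex.I_sq

/-- Complex conjugation on `C^∞(M)`. -/
def conjSmooth (f : smoothFun) : smoothFun := ⟨star f.1, star_mem_smooth f.2⟩

theorem subLaplacian_conj (f : smoothFun) :
    subLaplacianSmooth (conjSmooth f) = conjSmooth (subLaplacianSmooth f) := by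
  refine Subtype.ext ?_
  change -(fieldA (fieldA (star f.1)) + fieldB (fieldB (star f.1))) =
    star (-(fieldA (fieldA f.1) + fieldB (fieldB f.1)))
  rw [fieldA_star f.2, fieldA_star (fieldA_mem f.2), fieldB_star f.2, fieldB_star (fieldB_mem f.2),
    star_neg, star_add]

/-- The indices of the eigenfunctions: characters of the torus, and, for each frequency `n + 1` in
the central variable, the Hermite functions of degree `k` on the line, transported by the
Weil–Brezin transforms `p ≤ n`, and their complex conjugates. -/
abbrev EigIndex : Type := (ℤ × ℤ) ⊕ (Bool × {x : ℕ × ℕ × ℕ // x.2.1 ≤ x.1})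

/-- The eigenfunctions of the sub-Laplacian. -/
def eigFun : EigIndex → smoothFun
  | .inl w => ⟨torusFun w.1 w.2, torusFun_mem w.1 w.2⟩
  | .inr (false, x) => weilBrezin (Nat.succ_pos x.1.1) x.1.2.1 (hermitePoly (x.1.1 + 1) x.1.2.2)
  | .inr (true, x) =>
      conjSmooth (weilBrezin (Nat.succ_pos x.1.1) x.1.2.1 (hermitePoly (x.1.1 + 1) x.1.2.2))

/-- The eigenvalues of the sub-Laplacian. -/
def eigVal : EigIndex → ℝ
  | .inl w => (2 * Real.pi) ^ 2 * (w.1 ^ 2 + w.2 ^ 2)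
  | .inr (_, x) => 2 * Real.pi * (x.1.1 + 1 : ℕ) * (2 * x.1.2.2 + 1)

theorem subLaplacian_eigFun (i : EigIndex) :
    subLaplacianSmooth (eigFun i) = (eigVal i : ℂ) • eigFun i := by
  rcases i with w | ⟨_ | _, x⟩
  · exact subLaplacian_torusFun w.1 w.2
  · exact subLaplacian_hermite (Nat.succ_pos _) _ _
  · change subLaplacianSmooth (conjSmooth _) = _ • conjSmooth _
    rw [subLaplacian_conj, subLaplacian_hermite]
    refine Subtype.ext ?_
    change star (((eigVal (.inr (true, x)) : ℝ) : ℂ) • wfun (x.1.1 + 1) _ _) =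
      ((eigVal (.inr (true, x)) : ℝ) : ℂ) • star (wfun (x.1.1 + 1) _ _)
    rw [star_smul]
    congr 1
    exact Complex.conj_ofReal _

theorem inner_smoothToL2_left (f : smoothFun) (u : L2) :
    inner ℂ (smoothToL2 f) u = ∫ x, (starRingEnd ℂ) (f.1 (nilCoord x)) * u (nilCoord x)
      ∂(unitVol.prod (unitVol.prod unitVol)) := by
  rw [← integral_nilVol (f := fun x => (starRingEnd ℂ) (f.1 x) * u x)
    ((smooth_measurable (star_mem_smooth f.2)).mul (Lp.aestronglyMeasurable u)), L2.inner_def]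
  refine integral_congr_ae ?_
  filter_upwards [(memLp_of_smooth f.2 2).coeFn_toLp] with x hx
  change inner ℂ ((memLp_of_smooth f.2 2).toLp f.1 x) (u x) = _
  rw [hx, RCLike.inner_apply, mul_comm]

/-- The completeness criterion uses pairings without conjugation, the inner product conjugates its
first argument. Hence the character `(m, q)` is matched with `(-m, -q)`, and an unconjugated series
with the conjugate eigenfunction. -/
theorem eigFun_total (u : L2) (h : ∀ i, inner ℂ (smoothToL2 (eigFun i)) u = 0) : u = 0 := by
  have hu : Integrable (fun x => u (nilCoord x)) (unitVol.prod (unitVol.prod unitVol)) :=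
    measurePreserving_nilCoord.integrable_comp_of_integrable
      ((Lp.memLp u).integrable (by norm_num))
  simp only [inner_smoothToL2_left] at h
  have h1 := ae_eq_zero_of_orthogonal hu
    (fun m q => by
      rw [← h (.inl (-m, -q))]
      refine integral_congr_ae (Filter.Eventually.of_forall fun x => ?_)
      change ex (m * x.1 + q * x.2.1) * u (nilCoord x) =
        (starRingEnd ℂ) (ex ((-m : ℤ) * x.1 + (-q : ℤ) * x.2.1)) * u (nilCoord x)
      rw [conj_ex]
      congr 2
      push_cast
      ring)
    (fun n p k hp => by
      rw [← h (.inr (true, ⟨(n, p, k), hp⟩))]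
      refine integral_congr_ae (Filter.Eventually.of_forall fun x => ?_)
      change _ = (starRingEnd ℂ) (star (wsum (n + 1) p (hermitePoly (n + 1) k) x.1 x.2.1 x.2.2)) * _
      rw [starRingEnd_apply, star_star])
    (fun n p k hp => by
      rw [← map_zero (starRingEnd ℂ), ← h (.inr (false, ⟨(n, p, k), hp⟩)), ← integral_conj]
      refine integral_congr_ae (Filter.Eventually.of_forall fun x => ?_)
      simp only [map_mul, Complex.conj_conj]
      rfl)
  have h2 : ∀ᵐ x ∂(unitVol.prod (unitVol.prod unitVol)).map nilCoord, u x = 0 :=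
    (ae_map_iff measurable_nilCoord.aemeasurable
      (measurableSet_eq_fun (Lp.stronglyMeasurable u).measurable measurable_const)).2 h1
  rw [← nilVol_eq] at h2
  exact (Lp.eq_zero_iff_ae_eq_zero).2 h2

theorem eigVal_finite (R : ℝ) : {i | eigVal i ≤ R}.Finite := by
  obtain ⟨N, hN⟩ := exists_nat_ge R
  have hπ := Real.pi_gt_three
  -- The factors `(2π)²` and `2π` exceed `1`, so bounded eigenvalues bound the integer indices; `p ≤
  -- n` bounds the remaining one.
  have h1 : {w : ℤ × ℤ | eigVal (.inl w) ≤ R}.Finite := by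
    refine (Set.finite_Icc ((-N, -N) : ℤ × ℤ) (N, N)).subset fun w hw => ?_
    have h2 : (2 * Real.pi) ^ 2 * ((w.1 : ℝ) ^ 2 + (w.2 : ℝ) ^ 2) ≤ N :=
      le_trans hw hN
    have hs : (w.1 : ℝ) ^ 2 + (w.2 : ℝ) ^ 2 ≤ N := by
      refine le_trans (le_mul_of_one_le_left (by positivity) ?_) h2
      nlinarith
    have hs' : w.1 ^ 2 + w.2 ^ 2 ≤ (N : ℤ) := by exact_mod_cast hs
    have hb : ∀ a b : ℤ, a ^ 2 + b ^ 2 ≤ N → |a| ≤ N := fun a b hab =>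
      abs_le.2 ⟨by nlinarith [Int.le_self_sq (-a), sq_nonneg b],
        by nlinarith [Int.le_self_sq a, sq_nonneg b]⟩
    have f1 := hb _ _ hs'
    have f2 := hb w.2 w.1 (by rwa [add_comm])
    exact ⟨⟨(abs_le.1 f1).1, (abs_le.1 f2).1⟩, ⟨(abs_le.1 f1).2, (abs_le.1 f2).2⟩⟩
  have h2 : {y : Bool × {x : ℕ × ℕ × ℕ // x.2.1 ≤ x.1} | eigVal (.inr y) ≤ R}.Finite := by
    have hfin : {x : {x : ℕ × ℕ × ℕ // x.2.1 ≤ x.1} | x.1 ≤ (N, N, N)}.Finite :=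
      (Set.finite_Iic ((N, N, N) : ℕ × ℕ × ℕ)).preimage Subtype.val_injective.injOn
    refine ((Set.finite_univ (α := Bool)).prod hfin).subset ?_
    rintro ⟨s, ⟨n, p, k⟩, hp⟩ hy
    have h3 : 2 * Real.pi * ((n + 1 : ℕ) : ℝ) * (2 * (k : ℝ) + 1) ≤ N := le_trans hy hN
    push_cast at h3
    have hn0 : (0 : ℝ) ≤ n := n.cast_nonneg
    have hk0 : (0 : ℝ) ≤ k := k.cast_nonneg
    have h4 : ((n : ℝ) + 1) * (2 * k + 1) ≤ N := by nlinarith [mul_nonneg hn0 hk0]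
    have hn : (n : ℝ) ≤ N := by nlinarith [mul_nonneg hn0 hk0]
    have hk : (k : ℝ) ≤ N := by nlinarith [mul_nonneg hn0 hk0]
    have hn' : n ≤ N := by exact_mod_cast hn
    have hk' : k ≤ N := by exact_mod_cast hk
    exact ⟨mem_univ _, hn', le_trans hp hn', hk'⟩
  refine ((h1.image Sum.inl).union (h2.image Sum.inr)).subset ?_
  rintro (w | y) hi
  · exact Or.inl ⟨w, hi, rfl⟩
  · exact Or.inr ⟨y, hi, rfl⟩

theorem isEigenFamily :
    IsEigenFamily subLaplacianMin (fun i => smoothToL2 (eigFun i)) eigVal where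
  symm := subLaplacianMin_symm
  mem i := by
    refine ⟨⟨smoothToL2 (eigFun i), ⟨_, rfl⟩⟩, rfl, ?_⟩
    rw [subLaplacianMin_apply, subLaplacian_eigFun, map_smul]
  total := eigFun_total
  fin := eigVal_finite

theorem eigenspace_subLaplacian (μ : ℝ) : eigenspace subLaplacian ((μ ^ 2 : ℝ) : ℂ) =
    eigSpan (fun i => smoothToL2 (eigFun i)) eigVal (μ ^ 2) :=
  isEigenFamily.eigenspace_closure_eq (μ ^ 2)

instance (μ : ℝ) : FiniteDimensional ℂ (eigenspace subLaplacian ((μ ^ 2 : ℝ) : ℂ)) := by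
  rw [eigenspace_subLaplacian]
  exact isEigenFamily.finiteDimensional _

theorem specProj_eq (μ : ℝ) :
    specProj μ = (eigenspace subLaplacian ((μ ^ 2 : ℝ) : ℂ)).starProjection := by
  have h : (eigenspace subLaplacian ((μ ^ 2 : ℝ) : ℂ)).topologicalClosure =
      eigenspace subLaplacian ((μ ^ 2 : ℝ) : ℂ) :=
    (Submodule.closed_of_finiteDimensional _).submodule_topologicalClosure_eq
  unfold specProj sqrtProj
  congr 1

theorem memLp_top_of_eigenspace (μ : ℝ) (g : L2)
    (hg : g ∈ eigenspace subLaplacian ((μ ^ 2 : ℝ) : ℂ)) : MemLp g ⊤ nilVol := by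
  have hle : eigenspace subLaplacian ((μ ^ 2 : ℝ) : ℂ) ≤ LinearMap.range smoothToL2 := by
    rw [eigenspace_subLaplacian]
    refine Submodule.span_le.2 ?_
    rintro _ ⟨i, -, rfl⟩
    exact ⟨_, rfl⟩
  obtain ⟨f, rfl⟩ := hle hg
  exact (memLp_of_smooth f.2 ⊤).ae_eq (memLp_of_smooth f.2 2).coeFn_toLp.symm

theorem opNorm_specProj_lt_top (μ : ℝ) : opNorm 2 4 (specProj μ) < ⊤ := by
  rw [specProj_eq]
  exact opNorm_lt_top _ (memLp_top_of_eigenspace μ)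

theorem opNorm_specProj_dual (μ : ℝ) :
    opNorm 2 4 (specProj μ) = opNorm (4 / 3) 2 (specProj μ) := by
  rw [specProj_eq]
  exact opNorm_dual _ (memLp_top_of_eigenspace μ)

end HeisNil
end

noncomputable section
namespace HeisNil

/-! ### Concentrated eigenfunctions -/

theorem integral_ex_unitVol (m : ℤ) : ∫ x, ex (m * x) ∂unitVol = if m = 0 then 1 else 0 := by
  split_ifs with hm
  · simp [hm, ex]
  · have hc : (2 * Real.pi * Complex.I * m : ℂ) ≠ 0 := by
      simp [Real.pi_ne_zero, hm]
    have hd : ∀ x : ℝ, HasDerivAt (fun x : ℝ => (2 * Real.pi * Complex.I * m : ℂ)⁻¹ * ex (m * x))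
        (ex (m * x)) x := by
      intro x
      have h1 : HasDerivAt (fun t : ℝ => ((m * t : ℝ) : ℂ)) m x := by
        simpa using ((hasDerivAt_id x).const_mul (m : ℝ)).ofReal_comp
      have h2 := ((h1.const_mul (2 * Real.pi * Complex.I)).cexp).const_mul
        (2 * Real.pi * Complex.I * m : ℂ)⁻¹
      refine h2.congr_deriv ?_
      rw [ex]
      field_simp
    rw [integral_unitVol_deriv hd (by fun_prop), mul_one, mul_zero, ex_int]
    simp [ex]

theorem coeffBC_conj_wsum {n : ℕ} (hn : 0 < n) (p q : ℤ) (a : ℝ) :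
    HasSum (fun j : ℤ => if q = n * j + p then (starRingEnd ℂ) (wcoef n p 1 (a + j)) else 0)
      (coeffBC (fun x => (starRingEnd ℂ) (wsum n p 1 x.1 x.2.1 x.2.2)) n q a) := by
  let F : ℤ → ℝ × ℝ → ℂ := fun j y => (starRingEnd ℂ) (wcoef n p 1 (a + j)) *
    ex ((q - (n * j + p) : ℤ) * y.1)
  have hterm : ∀ (y : ℝ × ℝ) (j : ℤ),
      F j y = ex (q * y.1 + n * y.2) * (starRingEnd ℂ) (wterm n p 1 a y.1 y.2 j) := fun y j => by
    simp only [F]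
    rw [wterm_eq, map_mul, conj_ex, mul_left_comm, ← ex_add]
    congr 2
    push_cast
    ring
  have hF : ∀ j, Integrable (F j) (unitVol.prod unitVol) := fun j =>
    Continuous.integrable_unitVol₂ (by fun_prop)
  have hnorm : ∀ j y, ‖F j y‖ = ‖wterm n p 1 a 0 0 j‖ := fun j y => by
    simp only [F]
    rw [norm_mul, norm_ex, mul_one, RCLike.norm_conj, wterm_eq, norm_mul, norm_ex, mul_one]
  have h := hasSum_integral_of_summable_integral_norm hF (by
    simp only [hnorm, integral_const, probReal_univ, one_smul]
    exact (summable_wterm hn p 1 a 0 0).norm)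
  have hint : ∀ j, ∫ y, F j y ∂(unitVol.prod unitVol) =
      if q = n * j + p then (starRingEnd ℂ) (wcoef n p 1 (a + j)) else 0 := fun j => by
    rw [integral_prod _ (hF j)]
    simp only [F, integral_const, probReal_univ, one_smul]
    rw [integral_const_mul, integral_ex_unitVol]
    simp only [sub_eq_zero, mul_ite, mul_one, mul_zero]
  have hsum : ∫ y, ∑' j, F j y ∂(unitVol.prod unitVol) =
      coeffBC (fun x => (starRingEnd ℂ) (wsum n p 1 x.1 x.2.1 x.2.2)) n q a := by
    rw [coeffBC]
    refine integral_congr_ae (Filter.Eventually.of_forall fun y => ?_)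
    simp only [hterm, tsum_mul_left, wsum]
    rw [Complex.conj_tsum]
    rfl
  rw [hsum] at h
  simpa only [hint] using h

theorem conj_wcoef_one (n : ℕ) (p : ℤ) (y : ℝ) :
    (starRingEnd ℂ) (wcoef n p 1 y) = wcoef n p 1 y := by
  rw [wcoef, Polynomial.eval_one, one_mul, Complex.conj_ofReal]

/-- Distinct residues modulo `n` use disjoint sets of frequencies in `b`; this makes different theta
functions orthogonal. -/
theorem coeffBC_conj_wsum_eq {n : ℕ} (hn : 0 < n) {p r : ℕ} (hp : p < n) (hr : r < n) (j : ℤ)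
    (a : ℝ) : coeffBC (fun x => (starRingEnd ℂ) (wsum n r 1 x.1 x.2.1 x.2.2)) n (n * j + p) a =
      if p = r then wcoef n p 1 (a + j) else 0 := by
  refine (coeffBC_conj_wsum hn r (n * j + p) a).unique ?_
  split_ifs with hpr
  · subst hpr
    refine (hasSum_ite_eq j (wcoef n p 1 (a + j))).congr_fun fun i => ?_
    have hn' : (n : ℤ) ≠ 0 := by exact_mod_cast hn.ne'
    by_cases hij : i = j
    · simp [hij, conj_wcoef_one]
    · have : ¬(n * j + p : ℤ) = n * i + p := fun h => by
        have h1 : (n : ℤ) * j = n * i := by linarith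
        exact hij (mul_left_cancel₀ hn' h1).symm
      rw [if_neg this, if_neg hij]
  · refine hasSum_zero.congr_fun fun i => ?_
    rw [if_neg]
    intro h
    have h1 := congrArg (fun z : ℤ => z % n) h
    simp only [Int.mul_add_emod_self_left] at h1
    rw [Int.emod_eq_of_lt (by positivity) (by exact_mod_cast hp),
      Int.emod_eq_of_lt (by positivity) (by exact_mod_cast hr)] at h1
    exact hpr (by exact_mod_cast h1)

/-- The pieces reassemble to `∫ exp(-2πn y²) dy` over the line. -/
theorem integral_wcoef_sq {n : ℕ} (hn : 0 < n) (p : ℤ) :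
    HasSum (fun j : ℤ => ∫ a, wcoef n p 1 (a + j) * wcoef n p 1 (a + j) ∂unitVol)
      ((√(1 / (2 * n)) : ℝ) : ℂ) := by
  have hb : 0 < 2 * Real.pi * n := by positivity
  have h1 : ∀ y, wcoef n p 1 y * wcoef n p 1 y =
      ((Real.exp (-(2 * Real.pi * n) * (y + p / n) ^ 2) : ℝ) : ℂ) := fun y => by
    rw [wcoef, Polynomial.eval_one, one_mul, ← Complex.ofReal_mul, ← Real.exp_add]
    congr 2
    ring
  have hi : Integrable fun y : ℝ => Real.exp (-(2 * Real.pi * n) * (y + p / n) ^ 2) :=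
    (integrable_exp_neg_mul_sq hb).comp_add_right (p / n : ℝ)
  have h2 : ∫ y, wcoef n p 1 y * wcoef n p 1 y = ((√(1 / (2 * n)) : ℝ) : ℂ) := by
    simp only [h1]
    rw [integral_complex_ofReal, integral_add_right_eq_self
      (fun y : ℝ => Real.exp (-(2 * Real.pi * n) * y ^ 2)), integral_gaussian]
    congr 2
    field_simp
  rw [← h2]
  refine hasSum_shifts (w := fun y => wcoef n p 1 y * wcoef n p 1 y) ?_
  simp only [h1]
  exact hi.ofReal

theorem inner_weilBrezin_one {n : ℕ} (hn : 0 < n) {p r : ℕ} (hp : p < n) (hr : r < n) :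
    inner ℂ (smoothToL2 (weilBrezin hn r 1)) (smoothToL2 (weilBrezin hn p 1)) =
      if p = r then ((√(1 / (2 * n)) : ℝ) : ℂ) else 0 := by
  have hc : Continuous fun x : ℝ × ℝ × ℝ => wsum n r 1 x.1 x.2.1 x.2.2 :=
    continuous_lift (wfun_mem hn r 1)
  have hV : Integrable (fun x : ℝ × ℝ × ℝ => (starRingEnd ℂ) (wsum n r 1 x.1 x.2.1 x.2.2))
      (unitVol.prod (unitVol.prod unitVol)) :=
    Continuous.integrable_unitVol₃ (Complex.continuous_conj.comp hc)
  have h := hasSum_integral_wsum_mul hn p 1 hV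
  have h2 : inner ℂ (smoothToL2 (weilBrezin hn r 1)) (smoothToL2 (weilBrezin hn p 1)) =
      ∫ x : ℝ × ℝ × ℝ, wsum n p 1 x.1 x.2.1 x.2.2 *
        (starRingEnd ℂ) (wsum n r 1 x.1 x.2.1 x.2.2) ∂(unitVol.prod (unitVol.prod unitVol)) := by
    rw [inner_smoothToL2, integral_nilVol
      (smooth_measurable (mul_mem_smooth (star_mem_smooth (weilBrezin hn r 1).2)
        (weilBrezin hn p 1).2))]
    refine integral_congr_ae (Filter.Eventually.of_forall fun x => ?_)
    exact mul_comm _ _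
  rw [h2]
  refine h.unique ?_
  simp only [coeffBC_conj_wsum_eq hn hp hr]
  split_ifs with hpr
  · exact integral_wcoef_sq hn p
  · simp only [mul_zero, integral_zero]
    exact hasSum_zero

/-- The sum of the first `M` theta functions of frequency `n`. -/
def thetaSum {n : ℕ} (hn : 0 < n) (M : ℕ) : smoothFun :=
  ∑ p ∈ Finset.range M, weilBrezin hn p 1

theorem norm_sq_thetaSum {n : ℕ} (hn : 0 < n) {M : ℕ} (hM : M ≤ n) :
    ‖smoothToL2 (thetaSum hn M)‖ ^ 2 = M * √(1 / (2 * n)) := by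
  have h : inner ℂ (smoothToL2 (thetaSum hn M)) (smoothToL2 (thetaSum hn M)) =
      ((M * √(1 / (2 * n)) : ℝ) : ℂ) := by
    rw [thetaSum, map_sum, sum_inner]
    have : ∀ r ∈ Finset.range M, inner ℂ (smoothToL2 (weilBrezin hn r 1))
        (∑ p ∈ Finset.range M, smoothToL2 (weilBrezin hn p 1)) =
        ((√(1 / (2 * n)) : ℝ) : ℂ) := by
      intro r hr
      rw [inner_sum]
      have hr' := (Finset.mem_range.1 hr)
      rw [Finset.sum_congr rfl fun p hp => inner_weilBrezin_one hn
        ((Finset.mem_range.1 hp).trans_le hM) (hr'.trans_le hM)]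
      simp [hr']
    rw [Finset.sum_congr rfl this]
    simp
  rw [inner_self_eq_norm_sq_to_K] at h
  refine Complex.ofReal_injective ?_
  rw [Complex.ofReal_pow]
  exact h

/-- The symbol `1` is the Hermite polynomial of degree zero, so every summand has eigenvalue `2πn`,
whatever `p`. -/
theorem thetaSum_mem_eigenspace {n : ℕ} (hn : 0 < n) (M : ℕ) {μ : ℝ}
    (hμ : μ ^ 2 = 2 * Real.pi * n) :
    smoothToL2 (thetaSum hn M) ∈ eigenspace subLaplacian ((μ ^ 2 : ℝ) : ℂ) := by
  rw [thetaSum, map_sum]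
  refine Submodule.sum_mem _ fun p _ => ?_
  have hle := LinearPMap.le_closure subLaplacianMin
  refine mem_eigenspace.2 ⟨⟨smoothToL2 (weilBrezin hn p 1), hle.1 ⟨_, rfl⟩⟩, rfl, ?_⟩
  have h1 := subLaplacian_hermite hn p 0
  rw [hermitePoly] at h1
  have h2 := subLaplacianMin_apply (weilBrezin hn p 1)
  rw [h1, map_smul] at h2
  rw [hμ, show 2 * Real.pi * (n : ℝ) = 2 * Real.pi * n * (2 * (0 : ℕ) + 1) by simp, ← h2]
  exact (hle.2 rfl).symm

/-! ### Pointwise and `L⁴` lower bounds for sums of theta functions. -/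

theorem hasSum_half_pow_natAbs : HasSum (fun j : ℤ => (1 / 2 : ℝ) ^ j.natAbs) 3 := by
  have h2 : HasSum (fun k : ℕ => (1 / 2 : ℝ) ^ (-((k : ℤ) + 1)).natAbs) 1 := by
    have h3 := hasSum_geometric_two.mul_left (1 / 2 : ℝ)
    rw [show (1 / 2 : ℝ) * 2 = 1 by norm_num] at h3
    refine h3.congr_fun fun k => ?_
    rw [show (-((k : ℤ) + 1)).natAbs = k + 1 by omega, pow_succ']
  have h1 : HasSum (fun k : ℕ => (1 / 2 : ℝ) ^ ((k : ℤ)).natAbs) 2 := by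
    simpa only [Int.natAbs_natCast] using hasSum_geometric_two
  have h3 : (2 : ℝ) + 1 = 3 := by norm_num
  exact h3 ▸ HasSum.of_nat_of_neg_add_one (f := fun j : ℤ => (1 / 2 : ℝ) ^ j.natAbs) h1 h2

theorem exp_neg_mul_le_half_pow (m : ℕ) : Real.exp (-(m : ℝ)) ≤ (1 / 2) ^ m := by
  rw [show -(m : ℝ) = m * (-1) by ring, Real.exp_nat_mul]
  refine pow_le_pow_left₀ (Real.exp_nonneg _) ?_ m
  rw [Real.exp_neg, one_div]
  exact inv_anti₀ (by norm_num) (by linarith [Real.add_one_le_exp (1 : ℝ)])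

/-- Once the common central phase is removed, the term `j = 0` has real part at least `19/100` and
the others are dominated by `2^(-|j|)/128`, of total at most `3/128`. -/
theorem wsum_re_lower {n : ℕ} (hn : 16 ≤ n) {p : ℕ} {a b : ℝ} (ha : 0 ≤ a) (hb : 0 ≤ b)
    (hx : (n : ℝ) * (a + p / n) ^ 2 ≤ 1 / 4) (hpb : p * b ≤ 1 / 16) (c : ℝ) :
    1 / 10 ≤ (wsum n p 1 a b c * ex (-(n * c))).re := by
  have hn0 : 0 < n := by omega
  have hn16 : (16 : ℝ) ≤ n := by exact_mod_cast hn
  have hπ := Real.pi_gt_three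
  have hπ4 := Real.pi_lt_d2
  have hp0 : (0 : ℝ) ≤ p / n := by positivity
  have hxs : a + p / n ≤ 1 / 8 := by nlinarith
  have hs := ((summable_wterm hn0 p 1 a b c).hasSum).mul_right (ex (-(n * c)))
  have hterm : ∀ j : ℤ, wterm n p 1 a b c j * ex (-(n * c)) =
      ((Real.exp (-Real.pi * n * (a + j + p / n) ^ 2) : ℝ) : ℂ) *
        ex (((n * j + p : ℤ) : ℝ) * b) := fun j => by
    rw [wterm_eq, mul_assoc, ← ex_add, wcoef, Polynomial.eval_one, one_mul]
    congr 2
    simp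
  have hre := Complex.hasSum_re hs
  have hlow := (hasSum_ite_eq (0 : ℤ) (19 / 100 : ℝ)).sub
    (hasSum_half_pow_natAbs.mul_left (1 / 128 : ℝ))
  refine le_trans ?_ (hasSum_le (fun j => ?_) hlow hre)
  · norm_num
  · rw [hterm, Complex.re_ofReal_mul]
    by_cases hj : j = 0
    · subst hj
      -- The exponent is at least `-π/4`, and `1 - 3.15/4 > 19/90`; times the cosine bound `9/10`
      -- this gives `19/100`.
      have e1 : (19 / 90 : ℝ) ≤ Real.exp (-Real.pi * n * (a + (0 : ℤ) + p / n) ^ 2) := by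
        refine le_trans ?_ (Real.add_one_le_exp _)
        push_cast
        rw [add_zero]
        nlinarith
      have e2 : (9 / 10 : ℝ) ≤ (ex (((n * 0 + p : ℤ) : ℝ) * b)).re := by
        have : 2 * Real.pi * Complex.I * ((((n * 0 + p : ℤ) : ℝ) * b : ℝ) : ℂ) =
            ((2 * Real.pi * (p * b) : ℝ) : ℂ) * Complex.I := by push_cast; ring
        rw [ex, this, Complex.exp_ofReal_mul_I_re]
        refine le_trans ?_ (Real.one_sub_sq_div_two_le_cos (x := 2 * Real.pi * (p * b)))
        have h0 : 0 ≤ p * b := by positivity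
        have h1 : 2 * Real.pi * (p * b) ≤ 2 / 5 := by nlinarith
        have h2 : 0 ≤ 2 * Real.pi * (p * b) := by positivity
        nlinarith
      simp only [if_true, Int.natAbs_zero, pow_zero, mul_one]
      nlinarith
    · rw [if_neg hj, zero_sub]
      have hj1 : 1 ≤ j.natAbs := Nat.one_le_iff_ne_zero.2 (Int.natAbs_ne_zero.2 hj)
      have hjr : (1 : ℝ) ≤ (j.natAbs : ℝ) := by exact_mod_cast hj1
      have hjabs : (j.natAbs : ℝ) = |(j : ℝ)| := by
        rw [Nat.cast_natAbs, Int.cast_abs]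
      have e1 : Real.exp (-Real.pi * n * (a + j + p / n) ^ 2) ≤
          1 / 128 * (1 / 2) ^ j.natAbs := by
        have h1 : |(j : ℝ)| * (7 / 8) ≤ |a + j + p / n| := by
          have h2 : |(j : ℝ)| ≤ |a + j + p / n| + |a + p / n| := by
            calc |(j : ℝ)| = |(a + j + p / n) - (a + p / n)| := by congr 1; ring
              _ ≤ _ := abs_sub _ _
          rw [abs_of_nonneg (by positivity : 0 ≤ a + p / n)] at h2
          rw [hjabs] at hjr
          linarith
        have h3 : (j.natAbs : ℝ) ^ 2 * (49 / 64) ≤ (a + j + p / n) ^ 2 := by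
          rw [← sq_abs (a + j + p / n), hjabs]
          nlinarith [abs_nonneg (j : ℝ)]
        -- Here `48 · 49/64 · j² ≥ 7 + |j|` for `|j| ≥ 1`; the `7` produces `1/128 = 2^(-7)`.
        have h4 : -Real.pi * n * (a + j + p / n) ^ 2 ≤ -((7 + j.natAbs : ℕ) : ℝ) := by
          have h5 : (48 : ℝ) ≤ Real.pi * n := by nlinarith
          push_cast
          nlinarith [mul_le_mul_of_nonneg_right h5 (sq_nonneg (a + j + p / n))]
        refine (Real.exp_le_exp.2 h4).trans ((exp_neg_mul_le_half_pow _).trans (le_of_eq ?_))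
        rw [pow_add]
        norm_num
      have e2 : -1 ≤ (ex (((n * j + p : ℤ) : ℝ) * b)).re := by
        have := Complex.abs_re_le_norm (ex (((n * j + p : ℤ) : ℝ) * b))
        rw [norm_ex] at this
        exact (abs_le.1 this).1
      have e3 := Real.exp_nonneg (-Real.pi * n * (a + j + p / n) ^ 2)
      nlinarith

theorem thetaSum_nilCoord {n : ℕ} (hn : 0 < n) (M : ℕ) (a b c : ℝ) :
    (thetaSum hn M).1 (nilCoord (a, b, c)) = ∑ p ∈ Finset.range M, wsum n p 1 a b c := by
  rw [thetaSum, Submodule.coe_sum, Finset.sum_apply]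
  rfl

/-- All summands share the phase `exp(2πi n c)`; after its removal their real parts are positive and
add up without cancellation. -/
theorem thetaSum_lower {n : ℕ} (hn : 16 ≤ n) {M : ℕ} (hM : (M : ℝ) ≤ √n / 4) {a b : ℝ}
    (ha : 0 ≤ a) (ha' : a ≤ 1 / (4 * √n)) (hb : 0 ≤ b) (hb' : b ≤ 1 / (4 * √n)) (c : ℝ) :
    (M / 10 : ℝ) ≤ ‖(thetaSum (show 0 < n by omega) M).1 (nilCoord (a, b, c))‖ := by
  have hn0 : (0 : ℝ) < n := by exact_mod_cast (show 0 < n by omega)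
  have hs : 0 < √(n : ℝ) := Real.sqrt_pos.2 hn0
  have hsq : √(n : ℝ) * √n = n := Real.mul_self_sqrt hn0.le
  rw [thetaSum_nilCoord]
  calc (M / 10 : ℝ) = ∑ p ∈ Finset.range M, (1 / 10 : ℝ) := by simp; ring
    _ ≤ ∑ p ∈ Finset.range M, (wsum n p 1 a b c * ex (-(n * c))).re := by
        refine Finset.sum_le_sum fun p hp => ?_
        have hpM : (p : ℝ) ≤ √n / 4 := by
          have : (p : ℝ) ≤ M := by exact_mod_cast (Finset.mem_range.1 hp).le
          linarith
        have hp0 : (0 : ℝ) ≤ p := p.cast_nonneg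
        have h1 : (p : ℝ) / n ≤ 1 / (4 * √n) := by
          rw [div_le_div_iff₀ hn0 (by positivity)]
          nlinarith
        refine wsum_re_lower hn ha hb ?_ ?_ c
        · have h2 : a + p / n ≤ 1 / (2 * √n) := by
            have : (1 : ℝ) / (4 * √n) + 1 / (4 * √n) = 1 / (2 * √n) := by field_simp; norm_num
            linarith
          have h3 : 0 ≤ a + p / n := by positivity
          calc (n : ℝ) * (a + p / n) ^ 2 ≤ n * (1 / (2 * √n)) ^ 2 := by gcongr
            _ = 1 / 4 := by
              rw [div_pow, mul_pow, sq (√(n : ℝ)), hsq]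
              field_simp
              norm_num
        · calc p * b ≤ √n / 4 * (1 / (4 * √n)) := by gcongr
            _ = 1 / 16 := by field_simp; norm_num
    _ = ((∑ p ∈ Finset.range M, wsum n p 1 a b c) * ex (-(n * c))).re := by
        rw [Finset.sum_mul, Complex.re_sum]
    _ ≤ ‖(∑ p ∈ Finset.range M, wsum n p 1 a b c) * ex (-(n * c))‖ := Complex.re_le_norm _
    _ = _ := by rw [norm_mul, norm_ex, mul_one]

/-- Chebyshev's inequality on the box `a, b < 1/(4√n)`, `c` free, of measure `1/(16n)`. -/
theorem eLpNorm_thetaSum_lower {n : ℕ} (hn : 16 ≤ n) {M : ℕ} (hM : (M : ℝ) ≤ √n / 4) :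
    ENNReal.ofReal ((M / 10) ^ 4 * (1 / (16 * n))) ≤
      eLpNorm (thetaSum (show 0 < n by omega) M).1 4 nilVol ^ 4 := by
  have hn0 : (0 : ℝ) < n := by exact_mod_cast (show 0 < n by omega)
  have hs4 : 4 ≤ √(n : ℝ) := Real.le_sqrt_of_sq_le (by norm_num; exact_mod_cast hn)
  have hsq : √(n : ℝ) * √n = n := Real.mul_self_sqrt hn0.le
  set δ : ℝ := 1 / (4 * √n) with hδ
  have hδ0 : 0 ≤ δ := by positivity
  have hδ1 : δ ≤ 1 := by
    rw [hδ, div_le_one (by positivity)]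
    linarith
  set f := (thetaSum (show 0 < n by omega) M).1 with hf
  have hmark := mul_meas_ge_le_pow_eLpNorm' nilVol (p := 4) (by norm_num) (by norm_num)
    (smooth_measurable (thetaSum (show 0 < n by omega) M).2) (ENNReal.ofReal (M / 10))
  have hset : ENNReal.ofReal (δ ^ 2) ≤ nilVol {x | ENNReal.ofReal (M / 10) ≤ ‖f x‖ₑ} := by
    have hsub : (Ico 0 δ ×ˢ (Ico 0 δ ×ˢ univ) : Set (ℝ × ℝ × ℝ)) ⊆
        nilCoord ⁻¹' {x | ENNReal.ofReal (M / 10) ≤ ‖f x‖ₑ} := by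
      rintro ⟨a, b, c⟩ ⟨ha, hb, -⟩
      change _ ≤ ‖f (nilCoord (a, b, c))‖ₑ
      rw [← ofReal_norm]
      exact ENNReal.ofReal_le_ofReal (thetaSum_lower hn hM ha.1 ha.2.le hb.1 hb.2.le c)
    have hv : unitVol (Ico 0 δ) = ENNReal.ofReal δ := by
      rw [unitVol, Measure.restrict_apply measurableSet_Ico,
        inter_eq_left.2 (Ico_subset_Ico_right hδ1), Real.volume_Ico, sub_zero]
    calc ENNReal.ofReal (δ ^ 2)
        = (unitVol.prod (unitVol.prod unitVol)) (Ico 0 δ ×ˢ (Ico 0 δ ×ˢ univ)) := by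
          rw [Measure.prod_prod, Measure.prod_prod, measure_univ, mul_one, hv,
            ← ENNReal.ofReal_mul hδ0, sq]
      _ ≤ (unitVol.prod (unitVol.prod unitVol)) (nilCoord ⁻¹' _) := measure_mono hsub
      _ ≤ _ := by
          rw [nilVol_eq]
          exact Measure.le_map_apply measurable_nilCoord.aemeasurable _
  have h4 : ((4 : ℝ≥0∞).toReal) = ((4 : ℕ) : ℝ) := by norm_num
  rw [h4, ENNReal.rpow_natCast, ENNReal.rpow_natCast] at hmark
  refine le_trans ?_ hmark
  rw [ENNReal.ofReal_mul (by positivity), ENNReal.ofReal_pow (by positivity)]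
  gcongr
  refine le_trans (le_of_eq ?_) hset
  congr 1
  rw [hδ, div_pow, mul_pow, sq (√(n : ℝ)), hsq]
  norm_num

end HeisNil
end

noncomputable section
namespace HeisNil

/-! ### The lower bound -/

theorem eLpNorm_smoothToL2 (f : smoothFun) (p : ℝ≥0∞) :
    eLpNorm (smoothToL2 f) p nilVol = eLpNorm f.1 p nilVol :=
  eLpNorm_congr_ae (memLp_of_smooth f.2 2).coeFn_toLp

theorem norm_thetaSum_pos {n : ℕ} (hn : 0 < n) {M : ℕ} (hM0 : 0 < M) (hM : M ≤ n) :
    0 < ‖smoothToL2 (thetaSum hn M)‖ := by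
  have h := norm_sq_thetaSum hn hM
  have h2 : 0 < (M : ℝ) * √(1 / (2 * n)) := by positivity
  rw [← h] at h2
  exact lt_of_pow_lt_pow_left₀ 2 (norm_nonneg _) (by simpa using h2)

theorem mul_eLpNorm_thetaSum_le {n : ℕ} (hn : 0 < n) {s : ℝ} (hs0 : 0 ≤ s)
    (hs : s ^ 4 ≤ n / 48 ^ 4) : ∃ M, 0 < M ∧ M ≤ n ∧
      ENNReal.ofReal s * ENNReal.ofReal ‖smoothToL2 (thetaSum hn M)‖ ≤
        eLpNorm (thetaSum hn M).1 4 nilVol := by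
  have hn0 : (0 : ℝ) < n := by exact_mod_cast hn
  by_cases h16 : n < 16
  -- For small `n` one theta function suffices: `s ≤ 1`, and the `L⁴` norm dominates the `L²` norm
  -- on a probability space.
  · refine ⟨1, one_pos, hn, ?_⟩
    have hn16 : (n : ℝ) ≤ 16 := by exact_mod_cast h16.le
    have hs1 : s ≤ 1 := by
      refine (pow_le_one_iff_of_nonneg hs0 four_ne_zero).1 (hs.trans ?_)
      rw [div_le_one (by positivity)]
      linarith
    calc ENNReal.ofReal s * ENNReal.ofReal ‖smoothToL2 (thetaSum hn 1)‖
        ≤ 1 * eLpNorm (thetaSum hn 1).1 2 nilVol := by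
          rw [← eLpNorm_smoothToL2, ofReal_norm, Lp.enorm_def]
          gcongr
          exact ENNReal.ofReal_le_one.2 hs1
      _ ≤ eLpNorm (thetaSum hn 1).1 4 nilVol := by
          rw [one_mul]
          exact eLpNorm_le_eLpNorm_of_exponent_le (by norm_num)
            (smooth_measurable (thetaSum hn 1).2)
  · have h16 : 16 ≤ n := by omega
    have hs4 : 4 ≤ √(n : ℝ) := Real.le_sqrt_of_sq_le (by norm_num; exact_mod_cast h16)
    have hsq : √(n : ℝ) * √n = n := Real.mul_self_sqrt hn0.le
    have hM : ((⌊√(n : ℝ) / 4⌋₊ : ℕ) : ℝ) ≤ √n / 4 := Nat.floor_le (by positivity)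
    have hM1 : √(n : ℝ) / 4 < (⌊√(n : ℝ) / 4⌋₊ : ℕ) + 1 := Nat.lt_floor_add_one _
    have hM0 : 0 < ⌊√(n : ℝ) / 4⌋₊ := Nat.floor_pos.2 (by linarith)
    generalize ⌊√(n : ℝ) / 4⌋₊ = M at hM hM1 hM0
    have hMr : (1 : ℝ) ≤ M := by exact_mod_cast hM0
    have hMn : M ≤ n := by
      have : (M : ℝ) ≤ n := by nlinarith
      exact_mod_cast this
    refine ⟨M, hM0, hMn, ?_⟩
    rw [← ENNReal.pow_le_pow_left_iff four_ne_zero, ← ENNReal.ofReal_mul hs0,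
      ← ENNReal.ofReal_pow (by positivity)]
    refine le_trans (ENNReal.ofReal_le_ofReal ?_) (eLpNorm_thetaSum_lower h16 hM)
    have h1 : ‖smoothToL2 (thetaSum hn M)‖ ^ 4 = M ^ 2 / (2 * n) := by
      rw [show 4 = 2 * 2 from rfl, pow_mul, norm_sq_thetaSum hn hMn, mul_pow,
        Real.sq_sqrt (by positivity), mul_one_div]
    -- Since `√n < 4(M+1) ≤ 8M`.
    have h2 : (n : ℝ) ≤ 64 * M ^ 2 := by nlinarith
    calc (s * ‖smoothToL2 (thetaSum hn M)‖) ^ 4 ≤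
          (n : ℝ) / 48 ^ 4 * ((M : ℝ) ^ 2 / (2 * n)) := by
          rw [mul_pow, h1]
          gcongr
      _ = (M : ℝ) ^ 2 / (2 * 48 ^ 4) := by field_simp
      -- The source of the constant `48`: `160000 · 64 ≤ 2 · 48⁴`.
      _ ≤ (M : ℝ) ^ 2 * ((M : ℝ) ^ 2 / (160000 * n)) := by
          rw [div_eq_mul_one_div]
          refine mul_le_mul_of_nonneg_left ?_ (by positivity)
          rw [div_le_div_iff₀ (by norm_num) (by positivity)]
          nlinarith
      _ = ((M : ℝ) / 10) ^ 4 * (1 / (16 * n)) := by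
          field_simp
          norm_num

/-- The constant is `1/96 = 1/(2 · 48)`, because `μ² = 2πn ≤ 2⁴ n`. Only `μ² = 2πn` matters, not
whether `μ` is a torus frequency. -/
theorem opNorm_specProj_lower {n : ℕ} (hn : 0 < n) {μ : ℝ} (hμ0 : 0 ≤ μ)
    (hμ : μ ^ 2 = 2 * Real.pi * n) :
    ENNReal.ofReal (1 / 96 * μ ^ (1 / 2 : ℝ)) ≤ opNorm 2 4 (specProj μ) := by
  have hs : (1 / 96 * μ ^ (1 / 2 : ℝ)) ^ 4 ≤ n / 48 ^ 4 := by
    have h1 : (μ ^ (1 / 2 : ℝ)) ^ 4 = 2 * Real.pi * n := by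
      rw [← hμ, ← Real.rpow_natCast, ← Real.rpow_mul hμ0, ← Real.rpow_natCast]
      norm_num
    rw [mul_pow, h1]
    have := Real.pi_le_four
    have hn0 : (0 : ℝ) ≤ n := n.cast_nonneg
    nlinarith
  obtain ⟨M, hM0, hM, h⟩ := mul_eLpNorm_thetaSum_le hn (by positivity) hs
  have hpos := norm_thetaSum_pos hn hM0 hM
  have h2 := le_opNorm (P := specProj μ) (q := 4) (Lp.memLp (smoothToL2 (thetaSum hn M)))
  have hP : specProj μ (smoothToL2 (thetaSum hn M)) = smoothToL2 (thetaSum hn M) := by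
    rw [specProj_eq]
    exact Submodule.starProjection_eq_self_iff.2 (thetaSum_mem_eigenspace hn M hμ)
  rw [hP, eLpNorm_smoothToL2 _ 4, ← Lp.enorm_def, ← ofReal_norm] at h2
  refine le_trans ?_ h2
  rwa [ENNReal.le_div_iff_mul_le (Or.inl (by simpa using hpos)) (Or.inl ENNReal.ofReal_ne_top)]

/-! ### The spectrum -/

theorem exists_of_mem_sqrtSpec {μ : ℝ} (hμ : μ ∈ sqrtSpec subLaplacian) (hT : μ ∉ torusFreq) :
    ∃ n : ℕ, 0 < n ∧ μ ^ 2 = 2 * Real.pi * n := by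
  obtain ⟨h0, hs⟩ := hμ
  obtain ⟨i, hi⟩ := isEigenFamily.mem_of_spec hs
  rcases i with w | ⟨b, x⟩
  · refine absurd ⟨w.1, w.2, ?_⟩ hT
    rw [← Real.sqrt_sq h0, ← hi, eigVal, Real.sqrt_mul (by positivity),
      Real.sqrt_sq (by positivity)]
  -- The eigenvalue of an excited state at one frequency is the ground-state eigenvalue at the
  -- frequency multiplied by `2k+1`.
  · refine ⟨(x.1.1 + 1) * (2 * x.1.2.2 + 1), by positivity, ?_⟩
    rw [← hi, eigVal]
    push_cast
    ring

theorem sqrt_mem_sqrtSpec {n : ℕ} (hn : 0 < n) :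
    √(2 * Real.pi * n) ∈ sqrtSpec subLaplacian := by
  refine ⟨Real.sqrt_nonneg _, ?_⟩
  rw [Real.sq_sqrt (by positivity)]
  obtain ⟨m, rfl⟩ : ∃ m, n = m + 1 := ⟨n - 1, by omega⟩
  let i : EigIndex := Sum.inr (false, ⟨(m, 0, 0), m.zero_le⟩)
  have h := isEigenFamily.eig_mem_spec (i := i) ?_
  · have hv : eigVal i = 2 * Real.pi * (m + 1 : ℕ) := by simp [i, eigVal]
    rwa [hv] at h
  · have h1 := norm_thetaSum_pos hn one_pos hn
    have h2 : thetaSum hn 1 = eigFun i := by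
      simp [thetaSum, i, eigFun, hermitePoly]
    rw [h2] at h1
    exact norm_pos_iff.1 h1

/-- Along `μ = √(2πn)` the quotient `μ^(1/2-α)` eventually exceeds `96 C`. -/
theorem opNorm_specProj_not_le {α : ℝ} (hα : α < 1 / 2) (C : ℝ) :
    ∃ μ ∈ sqrtSpec subLaplacian, 0 < μ ∧
      ENNReal.ofReal (C * μ ^ α) < opNorm 2 4 (specProj μ) := by
  have ht : Filter.Tendsto (fun n : ℕ => √(2 * Real.pi * n) ^ (1 / 2 - α)) Filter.atTop
      Filter.atTop :=
    (tendsto_rpow_atTop (by linarith)).comp (Real.tendsto_sqrt_atTop.comp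
      (tendsto_natCast_atTop_atTop.const_mul_atTop (by positivity)))
  obtain ⟨n, hC, hn⟩ :=
    ((ht.eventually_gt_atTop (96 * C)).and (Filter.eventually_gt_atTop 0)).exists
  have hμ : 0 < √(2 * Real.pi * n) := by positivity
  refine ⟨_, sqrt_mem_sqrtSpec hn, hμ, lt_of_lt_of_le ?_
    (opNorm_specProj_lower hn hμ.le (Real.sq_sqrt (by positivity)))⟩
  refine (ENNReal.ofReal_lt_ofReal_iff (by positivity)).2 ?_
  have h1 := mul_lt_mul_of_pos_right hC (Real.rpow_pos_of_pos hμ α)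
  rw [← Real.rpow_add hμ, sub_add_cancel] at h1
  linarith

end HeisNil
end

open HeisNil in
theorem proposition2 :
    (∃ C : ℝ, 0 < C ∧ ∀ μ ∈ sqrtSpec subLaplacian, 0 < μ →
      opNorm 2 4 (specProj μ) < ⊤ ∧
      opNorm 2 4 (specProj μ) = opNorm (4 / 3) 2 (specProj μ) ∧
      (μ ∉ torusFreq → ENNReal.ofReal (C * μ ^ (1 / 2 : ℝ)) ≤ opNorm 2 4 (specProj μ))) ∧
    (∀ α : ℝ, α < 1 / 2 → ¬ ∃ C : ℝ, ∀ μ ∈ sqrtSpec subLaplacian, 0 < μ →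
      opNorm 2 4 (specProj μ) ≤ ENNReal.ofReal (C * μ ^ α)) := by
  refine ⟨⟨1 / 96, by norm_num, fun μ hμ h0 => ⟨opNorm_specProj_lt_top μ, opNorm_specProj_dual μ,
    fun hT => ?_⟩⟩, ?_⟩
  · obtain ⟨n, hn, h⟩ := exists_of_mem_sqrtSpec hμ hT
    exact opNorm_specProj_lower hn h0.le h
  · rintro α hα ⟨C, hC⟩
    obtain ⟨μ, hμ, h0, h⟩ := opNorm_specProj_not_le hα C
    exact h.not_ge (hC μ hμ h0)
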